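/- **Generating functional.** For a spinor $z=(z^0,z^1)\in\mathbb C^2$ put $\check z=(-\overline{z^1},\overline{z^0})$, $[z|w\rangle=z^0w^1-z^1w^0$, and $d\mu(z)=\pi^{-2}e^{-|z^0|^2-|z^1|^2}d^4z$. Let $\Gamma$ be a finite oriented graph with a linear ordering of the edges meeting at each vertex, and let $\tau^x_{ee'}=-\tau^x_{e'e}$ be complex weights for pairs of edges meeting at a vertex $x$. Define $$\mathcal G_\Gamma(\tau)=\int\prod_{e}d\mu(w_e)\ \prod_{x}\exp\Big(\sum_{e<e'\text{ at }x}\tau^x_{ee'}\,[w^x_e|w^x_{e'}\rangle\Big),$$ where $w^x_e=w_e$ if $e$ is outgoing at $x$ and $w^x_e=\check w_e$ if $e$ is incoming at $x$. For homogeneous weights $\tau^x_{ee'}=iv$ if $e<e'$ and $\tau^x_{ee'}=-iv$ if $e>e'$, write $\mathcal G_\Gamma(iv)$. This denotes the integral where it converges absolutely, and otherwise its analytic continuation in $v\in\mathbb C$ from a neighbourhood of $0$ along connected open sets. **Lattice.** Let $\mathcal L$ be the square lattice with $M\times N$ vertices ($M,N\ge 1$) and free boundary, so that it has $|V|=MN$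 vertices and $|E|=(M-1)N+M(N-1)$ edges. Colour its vertices black and white like a chessboard and orient all edges from one colour to the other. At every black vertex order the edges cyclically (clockwise or counterclockwise), beginning with a fixed direction $a$. At every white vertex order them cyclically in the opposite sense, beginning with a fixed direction $b$ perpendicular to $a$. (At boundary vertices the ordering is restricted to the edges present.) **Theorem.** For every such orientation and ordering, let $g_P$ be the number of subgraphs of $\mathcal L$ with exactly $P$ edges in which every vertex has even valence, and let $p(v)=1+\sum_{P\ge1}g_Pv^P$. (Here $g_P=0$ for $1\le P<4$.) 1. The integral defining $\mathcal G_{\mathcal L}(iv)$ converges absolutely for all $v$ in a neighbourhood of $0$. For every $v\in\mathbb C$ at which it converges absolutely, $p(v)\ne0$ and $$\mathcal G_{\mathcal L}(iv)=\Big(1+\sum_{P}g_Pv^P\Big)^{-2}.$$ 2. The analytic continuation of $\mathcal G_{\mathcal L}(iv)$ is defined exactly at the points $v\in\mathbb C$ with $p(v)\neq0$. It is single-valued and is given there by the same formula. 3. Let $Z(\beta,J)=\sum_{\sigma\in\{\pm1\}^V}\exp\big(\beta J\sum_{(i,j)\in E}\sigma_i\sigma_j\big)$ be the partition function of the Ising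 model on $\mathcal L$. For all real $\beta,J$, with $v=\tanh(\beta J)$, $$\mathcal G_{\mathcal L}(iv)=\frac{2^{2|V|}}{(1-v^2)^{|E|}\,Z(\beta,J)^2}.$$ -/

import Mathlib

open Complex MeasureTheory Filter Topology

noncomputable section

/-! ### Spinors -/

/-- A spinor `|z⟩ = (z⁰, z¹)`. -/
abbrev Spinor : Type := Fin 2 → ℂ

/-- The contragredient spinor `|z] = (-conj z¹, conj z⁰)`. -/
def contragredient (z : Spinor) : Spinor :=
  ![-(starRingEnd ℂ (z 1)), starRingEnd ℂ (z 0)]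

/-- The holomorphic invariant `[z|w⟩ = z⁰ w¹ - z¹ w⁰`. -/
def spinorBracket (z w : Spinor) : ℂ := z 0 * w 1 - z 1 * w 0

/-- The density `π⁻² exp (-⟨z|z⟩)` of the Bargmann-Fock measure with respect to the Lebesgue
measure on `ℂ²`. -/
def bargmannDensity (z : Spinor) : ℝ :=
  (Real.pi ^ 2)⁻¹ * Real.exp (-(‖z 0‖ ^ 2 + ‖z 1‖ ^ 2))

/-! ### Oriented graphs with ordered vertices -/

/-- The vertex carrying a half-edge: `(e, true)` is the outgoing half of `e`, sitting at the source,
and `(e, false)` is the incoming half, sitting at the target. -/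
def halfEdgeVertex {V E : Type*} (src tgt : E → V) : E × Bool → V
  | (e, true) => src e
  | (e, false) => tgt e

/-- An oriented (multi-)graph together with a linear ordering, at each vertex, of the half-edges
at that vertex. The ordering is recorded by a rank function, injective at each vertex. -/
structure OrderedGraph (V E : Type*) where
  src : E → V
  tgt : E → V
  rank : E × Bool → ℕ
  rank_inj : ∀ h h' : E × Bool,
    halfEdgeVertex src tgt h = halfEdgeVertex src tgt h' → rank h = rank h' → h = h'

namespace OrderedGraph

variable {V E : Type*} [Fintype V] [DecidableEq V] [Fintype E]

/-- The vertex of a half-edge. -/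
def vertexOf (Γ : OrderedGraph V E) (h : E × Bool) : V := halfEdgeVertex Γ.src Γ.tgt h

/-- The spinor at a half-edge: `w_e` on outgoing half-edges and its contragredient on incoming
half-edges. -/
def halfEdgeSpinor (w : E → Spinor) : E × Bool → Spinor
  | (e, true) => w e
  | (e, false) => contragredient (w e)

/-- The vertex functional `exp (∑_{e < e'} τ_{ee'} [w_e|w_{e'}⟩)`, the sum running over all the pairs
of half-edges at `x` that are increasing for the ordering at `x`. -/
def vertexFunctional (Γ : OrderedGraph V E) (τ : E × Bool → E × Bool → ℂ) (x : V)
    (w : E → Spinor) : ℂ :=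
  Complex.exp (∑ p : (E × Bool) × (E × Bool) with
    Γ.vertexOf p.1 = x ∧ Γ.vertexOf p.2 = x ∧ Γ.rank p.1 < Γ.rank p.2,
      τ p.1 p.2 * spinorBracket (halfEdgeSpinor w p.1) (halfEdgeSpinor w p.2))

/-- The integrand of the generating functional, with respect to Lebesgue measure. -/
def generatingIntegrand (Γ : OrderedGraph V E) (τ : E × Bool → E × Bool → ℂ)
    (w : E → Spinor) : ℂ :=
  (∏ e, (bargmannDensity (w e) : ℂ)) * ∏ x, Γ.vertexFunctional τ x w

/-- The spin network generating functional
`𝒢_Γ(τ) = ∫ ∏_e dμ(w_e) ∏_v 𝒞_τ^{(v)}(w)`, as an integral over one spinor per edge. -/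
def generatingIntegral (Γ : OrderedGraph V E) (τ : E × Bool → E × Bool → ℂ) : ℂ :=
  ∫ w : E → Spinor, Γ.generatingIntegrand τ w

/-- The homogeneous antisymmetric weights: `τ_{ee'} = t` for `e < e'` and `τ_{ee'} = -t`
for `e > e'`. -/
def homogeneousWeight (Γ : OrderedGraph V E) (t : ℂ) (h h' : E × Bool) : ℂ :=
  if Γ.rank h < Γ.rank h' then t else if Γ.rank h' < Γ.rank h then -t else 0

/-- `c` is the value at `v` of the (analytically continued) function `v ↦ 𝒢_Γ(iv)`: some analytic
function on a connected open set containing `0` and `v` coincides with the defining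
integral near `0`, and takes the value `c` at `v`. -/
def HasGeneratingValue (Γ : OrderedGraph V E) (v c : ℂ) : Prop :=
  ∃ (U : Set ℂ) (F : ℂ → ℂ), IsOpen U ∧ IsPreconnected U ∧ 0 ∈ U ∧ v ∈ U ∧
    AnalyticOnNhd ℂ F U ∧
    (∀ᶠ u in 𝓝 (0 : ℂ), F u = Γ.generatingIntegral (Γ.homogeneousWeight (I * u))) ∧
    F v = c

/-- The valence of the vertex `x` in the subgraph with edge set `S`. -/
def valence (Γ : OrderedGraph V E) (S : Finset E) (x : V) : ℕ :=
  (S.filter fun e => Γ.src e = x).card + (S.filter fun e => Γ.tgt e = x).card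

/-- The number `g_P` of even-valent subgraphs with exactly `P` edges. -/
def numEven (Γ : OrderedGraph V E) (P : ℕ) : ℕ :=
  Nat.card {S : Finset E // S.card = P ∧ ∀ x, Even (Γ.valence S x)}

/-- The polynomial `1 + ∑_{P ≥ 1} g_P v ^ P`. -/
def evenPolynomial (Γ : OrderedGraph V E) (v : ℂ) : ℂ :=
  1 + ∑ P ∈ Finset.Icc 1 (Fintype.card E), (Γ.numEven P : ℂ) * v ^ P

/-- The Ising partition function `∑_σ exp (β J ∑_{(i,j)} σ_i σ_j)` at zero magnetic field, the
inner sum running over the edges. -/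
def isingPartition (Γ : OrderedGraph V E) (β J : ℝ) : ℝ :=
  ∑ σ : V → ℤˣ, Real.exp (β * J * ∑ e, ((σ (Γ.src e) : ℤ) : ℝ) * ((σ (Γ.tgt e) : ℤ) : ℝ))

end OrderedGraph

/-! ### The square lattice -/

/-- Vertices of the square lattice with `m` by `n` squares. -/
abbrev LatticeVertex (m n : ℕ) : Type := Fin (m + 1) × Fin (n + 1)

/-- Edges of the square lattice: `inl (i, j)` joins `(i, j)` to `(i + 1, j)` and `inr (i, j)` joins
`(i, j)` to `(i, j + 1)`. -/
abbrev LatticeEdge (m n : ℕ) : Type := (Fin m × Fin (n + 1)) ⊕ (Fin (m + 1) × Fin n)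

/-- The left or lower end of an edge. -/
def lowerEnd {m n : ℕ} : LatticeEdge m n → LatticeVertex m n
  | Sum.inl (i, j) => (i.castSucc, j)
  | Sum.inr (i, j) => (i, j.castSucc)

/-- The right or upper end of an edge. -/
def upperEnd {m n : ℕ} : LatticeEdge m n → LatticeVertex m n
  | Sum.inl (i, j) => (i.succ, j)
  | Sum.inr (i, j) => (i, j.succ)

/-- The direction in which an edge leaves its left or lower end. Directions are numbered
counterclockwise: right `0`, up `1`, left `2`, down `3`. -/
def edgeDirection {m n : ℕ} : LatticeEdge m n → ZMod 4
  | Sum.inl _ => 0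
  | Sum.inr _ => 1

/-- The black vertices of the chessboard colouring; the others are white. -/
def IsBlack {m n : ℕ} (x : LatticeVertex m n) : Prop := Even (x.1.val + x.2.val)

instance {m n : ℕ} (x : LatticeVertex m n) : Decidable (IsBlack x) := by
  unfold IsBlack; infer_instance

/-- The choices that fix edge orientation and vertex ordering on the square lattice. All edges point
from one colour to the other. At a black vertex the edges are ordered cyclically, starting with the
direction `startBlack`, counterclockwise if `sense = 1` and clockwise if `sense = -1`. At a white
vertex they are ordered cyclically in the opposite sense, starting with `startWhite`, a direction
perpendicular to `startBlack`. -/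
structure LatticeConvention where
  outOfBlack : Bool
  sense : ℤˣ
  startBlack : ZMod 4
  startWhite : ZMod 4
  perpendicular : startWhite = startBlack + 1 ∨ startWhite = startBlack - 1

/-- Whether the lower end of the edge `e` is its source. -/
def lowerIsSource {m n : ℕ} (c : LatticeConvention) (e : LatticeEdge m n) : Bool :=
  decide (IsBlack (lowerEnd e)) == c.outOfBlack

/-- The end of `e` carrying the half-edge `(e, b)`; outgoing halves sit at the source. -/
def latticeVertexOf {m n : ℕ} (c : LatticeConvention) (h : LatticeEdge m n × Bool) :
    LatticeVertex m n :=
  if h.2 = lowerIsSource c h.1 then lowerEnd h.1 else upperEnd h.1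

/-- The direction in which a half-edge leaves its vertex. -/
def latticeDirection {m n : ℕ} (c : LatticeConvention) (h : LatticeEdge m n × Bool) : ZMod 4 :=
  if h.2 = lowerIsSource c h.1 then edgeDirection h.1 else edgeDirection h.1 + 2

/-- The position of a half-edge in the ordering at its vertex. -/
def latticeRank {m n : ℕ} (c : LatticeConvention) (h : LatticeEdge m n × Bool) : ℕ :=
  if IsBlack (latticeVertexOf c h) then
    (((c.sense : ℤ) : ZMod 4) * (latticeDirection c h - c.startBlack)).val
  else
    (-((c.sense : ℤ) : ZMod 4) * (latticeDirection c h - c.startWhite)).val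

theorem halfEdgeVertex_lattice {m n : ℕ} (c : LatticeConvention) (h : LatticeEdge m n × Bool) :
    halfEdgeVertex (fun e => latticeVertexOf c (e, true)) (fun e => latticeVertexOf c (e, false)) h
      = latticeVertexOf c h := by
  rcases h with ⟨e, _ | _⟩ <;> rfl

theorem latticeRank_inj {m n : ℕ} (c : LatticeConvention) (h h' : LatticeEdge m n × Bool)
    (hv : latticeVertexOf c h = latticeVertexOf c h') (hr : latticeRank c h = latticeRank c h') :
    h = h' := by
  have hd : latticeDirection c h = latticeDirection c h' := by
    unfold latticeRank at hr
    rw [hv] at hr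
    have key : ∀ s : ℤˣ, ∀ a b d : ZMod 4, (((s : ℤ) : ZMod 4) * (a - d) = ((s : ℤ) : ZMod 4) *
        (b - d) → a = b) ∧ (-((s : ℤ) : ZMod 4) * (a - d) = -((s : ℤ) : ZMod 4) *
        (b - d) → a = b) := by
      intro s
      rcases Int.units_eq_one_or s with rfl | rfl <;> decide
    split_ifs at hr
    · exact (key _ _ _ _).1 (ZMod.val_injective 4 hr)
    · exact (key _ _ _ _).2 (ZMod.val_injective 4 hr)
  obtain ⟨e, b⟩ := h
  obtain ⟨e', b'⟩ := h'
  have h01 : (0 : ZMod 4) ≠ 1 := by decide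
  have h02 : (0 : ZMod 4) ≠ 2 := by decide
  have h03 : (0 : ZMod 4) ≠ 1 + 2 := by decide
  have h12 : (1 : ZMod 4) ≠ 2 := by decide
  have h13 : (1 : ZMod 4) ≠ 1 + 2 := by decide
  have h23 : (2 : ZMod 4) ≠ 1 + 2 := by decide
  have he : e = e' ∧ ((b = lowerIsSource c e) ↔ (b' = lowerIsSource c e')) := by
    unfold latticeDirection at hd
    unfold latticeVertexOf at hv
    by_cases p : b = lowerIsSource c e <;> by_cases p' : b' = lowerIsSource c e' <;>
    rcases e with ⟨i, j⟩ | ⟨i, j⟩ <;> rcases e' with ⟨i', j'⟩ | ⟨i', j'⟩ <;>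
    simp_all [edgeDirection, lowerEnd, upperEnd]
  obtain ⟨rfl, hb⟩ := he
  cases b <;> cases b' <;> cases hl : lowerIsSource c e <;> simp_all

/-- The square lattice with `m` by `n` squares, free boundary, and the edge orientation and vertex
ordering given by the convention `c`. -/
def squareLattice (m n : ℕ) (c : LatticeConvention) :
    OrderedGraph (LatticeVertex m n) (LatticeEdge m n) where
  src e := latticeVertexOf c (e, true)
  tgt e := latticeVertexOf c (e, false)
  rank := latticeRank c
  rank_inj h h' hv hr := by
    rw [halfEdgeVertex_lattice, halfEdgeVertex_lattice] at hv
    exact latticeRank_inj c h h' hv hr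

end

/-! Take as coordinates the first component `u_h` of the spinor at each half-edge `h`. The second
component is, up to sign, the conjugate of the coordinate at the other half of the same edge, so the
exponent of the integrand is a sesquilinear form in `u`. The integral is therefore a complex
Gaussian. It converges absolutely exactly when the Hermitian part of its matrix is positive
definite, and then equals the inverse determinant (`posDef_of_integrable_gaussian`,
`gaussian_of_posDef`, `generatingIntegral_eq`). The determinant is that of `P + tO`, where the
antisymmetric matrix `P` pairs the two halves of each edge and the antisymmetric matrix `O` records
the order at each vertex.

That determinant is the square of a Pfaffian, obtained here from fermionic Fock space
(`det_pairingMatrix_sub`). The vertices give a Gaussian vector whose coefficients are `t ^ (|A| /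
2)` on half-edge sets `A` even at each vertex, and the edges give a Gaussian functional. Their
pairing `q(t)` is a signed sum over even subgraphs. The Schwinger-Dyson equation says that the
two-point function divided by `q` inverts `P - tO`. With Jacobi's formula and the number operator
this gives `D' q = 2 D q'` for `D = det (P - tO)`, hence `D = q ^ 2`.

It remains to find the signs on the square lattice (`crossingParity_of_evenAt`). The parity of the
sign is a quadratic function on sets of edges. Toggling a face of an even subgraph `S` changes this
parity by the number of edges of `S` on the face, and changes `|S| / 2` by the same number modulo 2.
Every even subgraph reduces to the empty one by toggling faces, so the sign is `(-1) ^ (|S| / 2)`.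
The factor `i` in the weight cancels it, leaving the even polynomial `p`.

The rest is the identity theorem applied to `F p ^ 2 = 1`, and the high temperature expansion of the
Ising model, which produces the same polynomial. -/

set_option linter.unusedSectionVars false

/-! ### Gaussian integrals over `ℂⁿ` -/

section Gaussian

open Matrix
open scoped ComplexOrder

variable {n : Type*} [Fintype n] [DecidableEq n]

/-- The sesquilinear form `u ↦ u* B u`. -/
noncomputable def Matrix.sesqForm (B : Matrix n n ℂ) (u : n → ℂ) : ℂ := star u ⬝ᵥ (B *ᵥ u)

theorem Matrix.sesqForm_mulVec (B P : Matrix n n ℂ) (z : n → ℂ) :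
    B.sesqForm (P *ᵥ z) = (Pᴴ * B * P).sesqForm z := by
  simp [Matrix.sesqForm, star_mulVec, dotProduct_mulVec, vecMul_vecMul, mulVec_mulVec,
    Matrix.mul_assoc]

theorem Matrix.sesqForm_diagonal (d : n → ℂ) (z : n → ℂ) :
    (Matrix.diagonal d).sesqForm z = ∑ i, d i * (‖z i‖ : ℂ) ^ 2 := by
  simp only [Matrix.sesqForm, dotProduct, mulVec_diagonal, Pi.star_apply]
  refine Finset.sum_congr rfl fun i _ => ?_
  rw [← Complex.conj_mul']
  simp only [RCLike.star_def]
  ring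

/-- The real determinant of a complex-linear map is the norm from `ℂ` to `ℝ` of its complex
determinant, that is `‖P.det‖ ^ 2`. -/
theorem Matrix.map_mulVec_volume {P : Matrix n n ℂ} (hP : P.det ≠ 0) :
    Measure.map (fun z => P *ᵥ z) (volume : Measure (n → ℂ)) =
      ENNReal.ofReal ((‖P.det‖ ^ 2)⁻¹) • volume := by
  have hdet : LinearMap.det ((Matrix.toLin' P).restrictScalars ℝ) = ‖P.det‖ ^ 2 := by
    rw [LinearMap.det_restrictScalars, LinearMap.det_toLin', Algebra.norm_complex_apply,
      Complex.normSq_eq_norm_sq]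
  have h := Measure.map_linearMap_addHaar_eq_smul_addHaar (volume : Measure (n → ℂ))
    (f := (Matrix.toLin' P).restrictScalars ℝ) (by rw [hdet]; positivity)
  rw [hdet, abs_of_nonneg (by positivity)] at h
  exact h

theorem Matrix.measurableEmbedding_mulVec {P : Matrix n n ℂ} (hP : P.det ≠ 0) :
    MeasurableEmbedding (fun z : n → ℂ => P *ᵥ z) := by
  let e : (n → ℂ) ≃ₗ[ℂ] (n → ℂ) := Matrix.toLinearEquiv' P
    (P.invertibleOfIsUnitDet (Ne.isUnit hP))
  exact e.toContinuousLinearEquiv.toHomeomorph.measurableEmbedding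

theorem Matrix.integral_comp_mulVec {P : Matrix n n ℂ} (hP : P.det ≠ 0) {F : Type*}
    [NormedAddCommGroup F] [NormedSpace ℝ F] (f : (n → ℂ) → F) :
    ∫ z, f (P *ᵥ z) = (‖P.det‖ ^ 2)⁻¹ • ∫ z, f z := by
  rw [← (Matrix.measurableEmbedding_mulVec hP).integral_map f, Matrix.map_mulVec_volume hP,
    integral_smul_measure, ENNReal.toReal_ofReal (by positivity)]

theorem Matrix.integrable_comp_mulVec {P : Matrix n n ℂ} (hP : P.det ≠ 0) {F : Type*}
    [NormedAddCommGroup F] (f : (n → ℂ) → F) :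
    Integrable (fun z => f (P *ᵥ z)) ↔ Integrable f := by
  have h := (Matrix.measurableEmbedding_mulVec hP).integrable_map_iff
    (μ := volume) (g := f)
  rw [Matrix.map_mulVec_volume hP, integrable_smul_measure (by simpa using hP)
    ENNReal.ofReal_ne_top] at h
  exact h.symm

/-! ### Diagonalization of Hermitian forms and evaluation of Gaussians -/

theorem Matrix.IsHermitian.exists_unitary_diagonal {A : Matrix n n ℂ} (hA : A.IsHermitian) :
    ∃ U : Matrix n n ℂ, Uᴴ * U = 1 ∧
      Uᴴ * A * U = Matrix.diagonal (fun i => (hA.eigenvalues i : ℂ)) := by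
  refine ⟨hA.eigenvectorUnitary, Unitary.coe_star_mul_self _, ?_⟩
  have h := hA.conjStarAlgAut_star_eigenvectorUnitary
  rw [Unitary.conjStarAlgAut_star_apply] at h
  exact h

theorem Matrix.det_ne_zero_of_conjTranspose_mul_mul_eq_one {H P : Matrix n n ℂ}
    (h : Pᴴ * H * P = 1) : P.det ≠ 0 := by
  intro h0
  have := congrArg Matrix.det h
  simp [h0] at this

/-- Simultaneous diagonalization of a positive definite and a Hermitian matrix. -/
theorem Matrix.PosDef.exists_simultaneous_diagonal {H K : Matrix n n ℂ} (hH : H.PosDef)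
    (hK : K.IsHermitian) : ∃ (P : Matrix n n ℂ) (k : n → ℝ), Pᴴ * H * P = 1 ∧
      Pᴴ * K * P = Matrix.diagonal (fun i => (k i : ℂ)) := by
  obtain ⟨U, -, hUH⟩ := hH.isHermitian.exists_unitary_diagonal
  set d := hH.isHermitian.eigenvalues
  have hd : ∀ i, 0 < d i := hH.isHermitian.posDef_iff_eigenvalues_pos.1 hH
  set Q := U * Matrix.diagonal (fun i => ((Real.sqrt (d i))⁻¹ : ℂ)) with hQ
  have hQH : Qᴴ * H * Q = 1 := by
    have : Qᴴ * H * Q = (Matrix.diagonal (fun i => ((Real.sqrt (d i))⁻¹ : ℂ)))ᴴ * (Uᴴ * H * U) *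
        Matrix.diagonal (fun i => ((Real.sqrt (d i))⁻¹ : ℂ)) := by
      simp only [hQ, conjTranspose_mul, Matrix.mul_assoc]
    rw [this, hUH, diagonal_conjTranspose, diagonal_mul_diagonal, diagonal_mul_diagonal,
      ← diagonal_one]
    congr 1
    funext i
    have h0 : (Real.sqrt (d i) : ℂ) ≠ 0 := by
      simpa using (Real.sqrt_pos.2 (hd i)).ne'
    have h1 : ((d i : ℝ) : ℂ) = (Real.sqrt (d i) : ℂ) * Real.sqrt (d i) := by
      rw [← Complex.ofReal_mul, Real.mul_self_sqrt (hd i).le]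
    simp only [Pi.star_apply, RCLike.star_def, map_inv₀, Complex.conj_ofReal, h1]
    field_simp
  -- A further unitary change of basis preserves the identity matrix, so it can diagonalize the
  -- second form without spoiling the first.
  have hQK : (Qᴴ * K * Q).IsHermitian := isHermitian_conjTranspose_mul_mul Q hK
  obtain ⟨W, hW, hWK⟩ := hQK.exists_unitary_diagonal
  refine ⟨Q * W, hQK.eigenvalues, ?_, ?_⟩
  · rw [conjTranspose_mul, show Wᴴ * Qᴴ * H * (Q * W) = Wᴴ * (Qᴴ * H * Q) * W by
      simp only [Matrix.mul_assoc], hQH, Matrix.mul_one, hW]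
  · rw [conjTranspose_mul, show Wᴴ * Qᴴ * K * (Q * W) = Wᴴ * (Qᴴ * K * Q) * W by
      simp only [Matrix.mul_assoc], hWK]

theorem integrable_cexp_neg_mul_norm_sq {b : ℂ} (hb : 0 < b.re) :
    Integrable (fun z : ℂ => Complex.exp (-(b * (‖z‖ : ℂ) ^ 2))) := by
  simpa using GaussianFourier.integrable_cexp_neg_mul_sq_norm_add hb 0 (0 : ℂ)

theorem integral_cexp_neg_mul_norm_sq {b : ℂ} (hb : 0 < b.re) :
    ∫ z : ℂ, Complex.exp (-(b * (‖z‖ : ℂ) ^ 2)) = Real.pi / b := by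
  simpa using GaussianFourier.integral_cexp_neg_mul_sq_norm (V := ℂ) hb

theorem gaussian_diagonal {d : n → ℂ} (hd : ∀ i, 0 < (d i).re) :
    Integrable (fun z => Complex.exp (-(Matrix.diagonal d).sesqForm z)) ∧
    ∫ z, Complex.exp (-(Matrix.diagonal d).sesqForm z) =
      (Real.pi : ℂ) ^ Fintype.card n / (Matrix.diagonal d).det := by
  have h : (fun z : n → ℂ => Complex.exp (-(Matrix.diagonal d).sesqForm z)) =
      fun z => ∏ i, Complex.exp (-(d i * (‖z i‖ : ℂ) ^ 2)) := by
    funext z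
    rw [Matrix.sesqForm_diagonal, ← Complex.exp_sum, Finset.sum_neg_distrib]
  rw [h]
  refine ⟨Integrable.fintype_prod (f := fun i (x : ℂ) => Complex.exp (-(d i * (‖x‖ : ℂ) ^ 2)))
    fun i => integrable_cexp_neg_mul_norm_sq (hd i), ?_⟩
  rw [integral_fintype_prod_volume_eq_prod
    (f := fun i (x : ℂ) => Complex.exp (-(d i * (‖x‖ : ℂ) ^ 2)))]
  simp only [fun i => integral_cexp_neg_mul_norm_sq (hd i), Matrix.det_diagonal,
    Finset.prod_div_distrib, Finset.prod_const, Finset.card_univ]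

/-- The complex Gaussian integral of a matrix with positive definite Hermitian part. -/
theorem gaussian_of_posDef {B : Matrix n n ℂ} (hB : (B + Bᴴ).PosDef) :
    Integrable (fun z => Complex.exp (-B.sesqForm z)) ∧ B.det ≠ 0 ∧
    ∫ z, Complex.exp (-B.sesqForm z) = (Real.pi : ℂ) ^ Fintype.card n / B.det := by
  -- `B` is half the sum of `B + Bᴴ` and `I` times this Hermitian matrix. Normalizing the first to
  -- the identity and diagonalizing the second makes `B` diagonal with entries of real part `1 / 2`,
  -- and the integral factors.
  have hK : (-I • (B - Bᴴ)).IsHermitian := by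
    rw [Matrix.IsHermitian, conjTranspose_smul, conjTranspose_sub, conjTranspose_conjTranspose]
    simp [sub_eq_add_neg, add_comm]
  obtain ⟨P, k, hP, hPK⟩ := hB.exists_simultaneous_diagonal hK
  have hPdet := Matrix.det_ne_zero_of_conjTranspose_mul_mul_eq_one hP
  set d : n → ℂ := fun i => (1 + I * k i) / 2 with hd
  have hBd : Pᴴ * B * P = Matrix.diagonal d := by
    have : B = (1 / 2 : ℂ) • ((B + Bᴴ) + I • (-I • (B - Bᴴ))) := by
      rw [smul_smul, mul_neg, I_mul_I, neg_neg, one_smul, add_add_sub_cancel, ← two_smul ℂ B,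
        smul_smul]
      norm_num
    rw [this, Matrix.mul_smul, Matrix.smul_mul, Matrix.mul_add, Matrix.add_mul, hP,
      Matrix.mul_smul, Matrix.smul_mul, hPK]
    ext i j
    rcases eq_or_ne i j with rfl | hij
    · simp [hd]; ring
    · simp [hij]
  have hdre : ∀ i, 0 < (d i).re := fun i => by
    have : d i = ((1 / 2 : ℝ) : ℂ) + ((k i / 2 : ℝ) : ℂ) * I := by simp [hd]; ring
    rw [this]; simp
  obtain ⟨h1, h2⟩ := gaussian_diagonal hdre
  -- The factor between the two determinants is the Jacobian of the substitution, so it drops out of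
  -- the result.
  have hdet : (‖P.det‖ : ℂ) ^ 2 * B.det = (Matrix.diagonal d).det := by
    rw [← hBd, det_mul, det_mul, det_conjTranspose, ← Complex.conj_mul']
    simp only [RCLike.star_def]; ring
  have hd0 : (Matrix.diagonal d).det ≠ 0 := by
    rw [Matrix.det_diagonal, Finset.prod_ne_zero_iff]
    intro i _ h0
    have := hdre i
    simp [h0] at this
  have hn : (‖P.det‖ : ℂ) ^ 2 ≠ 0 := by simpa using hPdet
  have hB0 : B.det ≠ 0 := by
    rintro h0; rw [h0, mul_zero] at hdet; exact hd0 hdet.symm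
  simp only [← hBd, ← Matrix.sesqForm_mulVec] at h1 h2
  rw [Matrix.integrable_comp_mulVec hPdet (fun z => Complex.exp (-B.sesqForm z))] at h1
  refine ⟨h1, hB0, ?_⟩
  rw [Matrix.integral_comp_mulVec hPdet (fun z => Complex.exp (-B.sesqForm z)), hBd, ← hdet] at h2
  rw [Complex.real_smul] at h2
  push_cast at h2
  field_simp at h2 ⊢
  linear_combination h2

theorem Matrix.sesqForm_conjTranspose (B : Matrix n n ℂ) (u : n → ℂ) :
    Bᴴ.sesqForm u = starRingEnd ℂ (B.sesqForm u) := by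
  simp only [Matrix.sesqForm]
  rw [← RCLike.star_def, star_dotProduct, star_mulVec, conjTranspose_conjTranspose,
    dotProduct_mulVec]

theorem Matrix.norm_cexp_neg_sesqForm_sq (B : Matrix n n ℂ) (u : n → ℂ) :
    ‖Complex.exp (-B.sesqForm u)‖ ^ 2 = Real.exp (-((B + Bᴴ).sesqForm u).re) := by
  have : (B + Bᴴ).sesqForm u = B.sesqForm u + Bᴴ.sesqForm u := by
    simp [Matrix.sesqForm, Matrix.add_mulVec]
  rw [Complex.norm_exp, ← Real.exp_nat_mul, this, Matrix.sesqForm_conjTranspose]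
  congr 1
  simp
  ring

/-- A complex Gaussian is integrable only if the Hermitian part of its matrix is positive
definite: otherwise stretching a bad direction would both shrink and not shrink the integral. -/
theorem posDef_of_integrable_gaussian {B : Matrix n n ℂ}
    (h : Integrable (fun z => Complex.exp (-B.sesqForm z))) : (B + Bᴴ).PosDef := by
  have hH : (B + Bᴴ).IsHermitian := by
    rw [Matrix.IsHermitian, conjTranspose_add, conjTranspose_conjTranspose, add_comm]
  by_contra hcon
  rw [hH.posDef_iff_eigenvalues_pos] at hcon
  push Not at hcon
  obtain ⟨i₀, hi₀⟩ := hcon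
  obtain ⟨U, hU, hUH⟩ := hH.exists_unitary_diagonal
  set d := hH.eigenvalues
  have hUdet : U.det ≠ 0 := Matrix.det_ne_zero_of_conjTranspose_mul_mul_eq_one (H := 1) (by simpa)
  set f : (n → ℂ) → ℝ := fun z => ‖Complex.exp (-B.sesqForm (U *ᵥ z))‖ with hf
  have hfi : Integrable f :=
    ((Matrix.integrable_comp_mulVec hUdet (fun z => Complex.exp (-B.sesqForm z))).2 h).norm
  have hf2 : ∀ z, f z ^ 2 = Real.exp (-∑ i, d i * ‖z i‖ ^ 2) := by
    intro z
    rw [hf]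
    dsimp only
    rw [Matrix.norm_cexp_neg_sesqForm_sq, Matrix.sesqForm_mulVec, hUH, Matrix.sesqForm_diagonal]
    norm_cast
  have hfpos : ∀ z, 0 < f z := fun z => by
    rw [hf]; exact norm_pos_iff.2 (Complex.exp_ne_zero _)
  -- `S` doubles the coordinate of a nonpositive eigenvalue. The integrand does not decrease under
  -- it, yet the substitution divides the positive integral by `2 ^ 2 = 4`.
  set S : Matrix n n ℂ := Matrix.diagonal (Function.update 1 i₀ 2) with hS
  have hSdet : S.det = 2 := by
    rw [hS, Matrix.det_diagonal, Finset.prod_update_of_mem (Finset.mem_univ _)]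
    simp
  have hSdet0 : S.det ≠ 0 := by rw [hSdet]; norm_num
  have hle : ∀ z, f z ≤ f (S *ᵥ z) := by
    intro z
    refine (pow_le_pow_iff_left₀ (hfpos _).le (hfpos _).le two_ne_zero).1 ?_
    rw [hf2, hf2]
    refine Real.exp_le_exp.2 (neg_le_neg (Finset.sum_le_sum fun i _ => ?_))
    rw [hS, mulVec_diagonal]
    rcases eq_or_ne i i₀ with rfl | hi
    · simp only [Function.update_self, norm_mul, mul_pow, Complex.norm_ofNat]
      nlinarith [sq_nonneg ‖z i‖, mul_nonneg (neg_nonneg.2 hi₀) (sq_nonneg ‖z i‖)]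
    · simp [Function.update_of_ne hi]
  have hint := integral_mono hfi ((Matrix.integrable_comp_mulVec hSdet0 f).2 hfi) hle
  rw [Matrix.integral_comp_mulVec hSdet0 f, hSdet] at hint
  have hpos : 0 < ∫ z, f z := by
    rw [integral_pos_iff_support_of_nonneg (fun z => (hfpos z).le) hfi,
      Function.support_eq_univ fun z => (hfpos z).ne']
    exact isOpen_univ.measure_pos _ Set.univ_nonempty
  norm_num at hint
  linarith

end Gaussian

/-! ### Jacobi's formula and a uniqueness lemma for polynomials -/

section Jacobi

open Polynomial

variable {n : Type*} [Fintype n] [DecidableEq n]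

theorem Matrix.eval_det_map_C_add_X_smul (A₀ A₁ : Matrix n n ℂ) (t : ℂ) :
    (A₀.map C + (X : ℂ[X]) • A₁.map C).det.eval t = (A₀ + t • A₁).det := by
  rw [← Polynomial.coe_evalRingHom, RingHom.map_det]
  congr 1
  ext i j
  simp only [Matrix.add_apply, Matrix.map_apply, Matrix.smul_apply, smul_eq_mul, RingHom.mapMatrix_apply,
    coe_evalRingHom, eval_add, eval_mul, eval_C, eval_X]

/-- Jacobi's formula. Translating the variable by `t` and factoring out the invertible matrix at `t`
leaves `det (1 + X M)`, whose derivative at zero is the trace of `M`. -/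
theorem Matrix.eval_derivative_det (A₀ A₁ : Matrix n n ℂ) (t : ℂ)
    (h : (A₀ + t • A₁).det ≠ 0) :
    (derivative (A₀.map C + (X : ℂ[X]) • A₁.map C).det).eval t =
      (A₀ + t • A₁).det * Matrix.trace ((A₀ + t • A₁)⁻¹ * A₁) := by
  set A := A₀ + t • A₁ with hA
  have hcomp : (A₀.map C + (X : ℂ[X]) • A₁.map C).det.comp (X + C t) =
      C A.det * (1 + (X : ℂ[X]) • (A⁻¹ * A₁).map C).det := by
    refine Polynomial.funext fun s => ?_
    have h1 : (1 + (X : ℂ[X]) • (A⁻¹ * A₁).map C).det.eval s = (1 + s • (A⁻¹ * A₁)).det := by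
      rw [← Matrix.eval_det_map_C_add_X_smul]
      simp
    rw [eval_comp, Matrix.eval_det_map_C_add_X_smul, eval_mul, eval_C, h1, ← Matrix.det_mul,
      Matrix.mul_add, Matrix.mul_one, Matrix.mul_smul, ← Matrix.mul_assoc,
      Matrix.mul_nonsing_inv _ (Ne.isUnit h), Matrix.one_mul, hA]
    simp only [eval_add, eval_X, eval_C, add_smul]
    congr 1
    abel
  have hd := congrArg (fun p => (derivative p).eval 0) hcomp
  simp only [derivative_comp, eval_mul, eval_comp, derivative_C_mul, eval_C,
    Matrix.derivative_det_one_add_X_smul] at hd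
  simpa using hd

/-- The difference `W = D - q ^ 2` satisfies the same linear equation and vanishes at zero. If `W`
were nonzero, the left side `W' q` would vanish there to one order less than `W`, and the right side
to at least the order of `W`. -/
theorem Polynomial.eq_sq_of_derivative_mul {D q : ℂ[X]} (h : derivative D * q = 2 * D * derivative q)
    (hD : D.eval 0 = 1) (hq : q.eval 0 = 1) : D = q ^ 2 := by
  rw [← sub_eq_zero]
  set W := D - q ^ 2 with hW
  have hWq : derivative W * q = 2 * W * derivative q := by
    rw [hW, derivative_sub, derivative_sq]
    simp only [C_ofNat]
    linear_combination h
  have hW0 : W.IsRoot 0 := by simp [hW, hD, hq]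
  have hq0 : q ≠ 0 := by rintro rfl; simp at hq
  by_contra hne
  have hdW : derivative W ≠ 0 := by
    intro h0
    rw [Polynomial.eq_C_of_derivative_eq_zero h0] at hW0 hne
    rw [IsRoot, eval_C] at hW0
    simp [hW0] at hne
  have hl : derivative W * q ≠ 0 := mul_ne_zero hdW hq0
  have hr : 2 * W * derivative q ≠ 0 := hWq ▸ hl
  have hm := congrArg (rootMultiplicity 0) hWq
  rw [rootMultiplicity_mul hl, rootMultiplicity_mul hr, rootMultiplicity_mul (left_ne_zero_of_mul hr),
    derivative_rootMultiplicity_of_root hW0,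
    rootMultiplicity_eq_zero (show ¬ q.IsRoot 0 by simp [hq])] at hm
  have : 0 < rootMultiplicity 0 W := (rootMultiplicity_pos hne).2 hW0
  omega

end Jacobi

/-! ### Fermionic Fock space -/

/-- The nontrivial character of `ZMod 2`. -/
noncomputable def paritySign (a : ZMod 2) : ℂ := (-1) ^ a.val

theorem paritySign_zero : paritySign 0 = 1 := by simp [paritySign]

theorem paritySign_one : paritySign 1 = -1 := by
  simp [paritySign, show (1 : ZMod 2).val = 1 from rfl]

theorem paritySign_add (a b : ZMod 2) : paritySign (a + b) = paritySign a * paritySign b := by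
  have h : ∀ a : ZMod 2, a = 0 ∨ a = 1 := by decide
  rcases h a with rfl | rfl <;> rcases h b with rfl | rfl <;>
    simp [paritySign_zero, paritySign_one, show (1 + 1 : ZMod 2) = 0 from rfl]

theorem paritySign_natCast (k : ℕ) : paritySign k = (-1) ^ k := by
  induction k with
  | zero => simp [paritySign_zero]
  | succ k ih => rw [Nat.cast_succ, paritySign_add, ih, paritySign_one, pow_succ]

theorem paritySign_mul_self (a : ZMod 2) : paritySign a * paritySign a = 1 := by
  rw [← paritySign_add, CharTwo.add_self_eq_zero, paritySign_zero]

theorem paritySign_sum_one {α : Type*} (s : Finset α) :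
    paritySign (∑ _k ∈ s, 1) = (-1) ^ s.card := by
  simp [paritySign_natCast]

section Fock

variable {H : Type*} [DecidableEq H] (κ : H → ℕ)

/-- The indicator of `h` preceding `k` in the ordering given by `κ`. -/
def precedes (h k : H) : ZMod 2 := if κ h < κ k then 1 else 0

theorem precedes_self (h : H) : precedes κ h h = 0 := by simp [precedes]

variable {κ} in
theorem precedes_add_precedes (hκ : κ.Injective) {h k : H} (hk : h ≠ k) :
    precedes κ h k + precedes κ k h = 1 := by
  have := hκ.ne hk
  unfold precedes
  split_ifs <;> first | rfl | omega

/-- The Jordan-Wigner sign of `h` relative to the occupied set `A`. -/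
noncomputable def fockSign (h : H) (A : Finset H) : ℂ := paritySign (∑ k ∈ A, precedes κ k h)

/-- The creation operator. -/
noncomputable def create (h : H) (f : Finset H → ℂ) (A : Finset H) : ℂ :=
  if h ∈ A then fockSign κ h A * f (A.erase h) else 0

/-- The annihilation operator. -/
noncomputable def annihilate (h : H) (f : Finset H → ℂ) (A : Finset H) : ℂ :=
  if h ∈ A then 0 else fockSign κ h A * f (insert h A)

theorem fockSign_mul_self (h : H) (A : Finset H) : fockSign κ h A * fockSign κ h A = 1 :=
  paritySign_mul_self _

theorem fockSign_insert (h : H) {k : H} {A : Finset H} (hk : k ∉ A) :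
    fockSign κ h (insert k A) = paritySign (precedes κ k h) * fockSign κ h A := by
  rw [fockSign, Finset.sum_insert hk, paritySign_add, fockSign]

theorem fockSign_erase (h : H) {k : H} {A : Finset H} (hk : k ∈ A) :
    fockSign κ h (A.erase k) = paritySign (precedes κ k h) * fockSign κ h A := by
  conv_rhs => rw [← Finset.insert_erase hk]
  rw [fockSign_insert κ h (Finset.notMem_erase k A), ← mul_assoc, paritySign_mul_self, one_mul]

variable {κ}

theorem create_create (hκ : κ.Injective) (h k : H) (f : Finset H → ℂ) :
    create κ h (create κ k f) = -create κ k (create κ h f) := by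
  funext A
  rcases eq_or_ne h k with rfl | hk
  · simp [create]
  · by_cases h1 : h ∈ A <;> by_cases h2 : k ∈ A <;>
      simp only [create, Pi.neg_apply, Finset.mem_erase, h1, h2, hk, hk.symm, ne_eq, not_false_eq_true,
        and_true, if_true, if_false, and_false, mul_zero, neg_zero]
    rw [fockSign_erase κ _ h1, fockSign_erase κ _ h2]
    have : paritySign (precedes κ h k) = -paritySign (precedes κ k h) := by
      have h3 := congrArg paritySign (precedes_add_precedes hκ hk)
      rw [paritySign_add, paritySign_one] at h3
      linear_combination paritySign (precedes κ k h) * h3 -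
        paritySign (precedes κ h k) * paritySign_mul_self (precedes κ k h)
    rw [this, Finset.erase_right_comm]
    ring

/-- The canonical anticommutation relation. For distinct `h` and `k` exactly one precedes the other,
which gives the relative minus sign of the two orders of operation. -/
theorem annihilate_create (hκ : κ.Injective) (h k : H) (f : Finset H → ℂ) :
    annihilate κ h (create κ k f) = (if h = k then f else 0) - create κ k (annihilate κ h f) := by
  funext A
  rcases eq_or_ne h k with rfl | hk
  · by_cases h1 : h ∈ A
    · simp only [annihilate, create, h1, if_true, Pi.sub_apply, Finset.notMem_erase, if_false,
        fockSign_erase κ _ h1, precedes_self, paritySign_zero, one_mul, Finset.insert_erase h1]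
      linear_combination (f A) * fockSign_mul_self κ h A
    · simp only [annihilate, create, h1, if_true, Pi.sub_apply, if_false, Finset.mem_insert_self,
        fockSign_insert κ _ h1, precedes_self, paritySign_zero, one_mul, Finset.erase_insert h1]
      linear_combination (f A) * fockSign_mul_self κ h A
  · by_cases h1 : h ∈ A <;> by_cases h2 : k ∈ A <;>
      simp only [create, annihilate, Pi.sub_apply, Finset.mem_erase, Finset.mem_insert, h1, h2, hk,
        hk.symm, ne_eq, not_false_eq_true, and_true, if_true, if_false, and_false, mul_zero,
        sub_zero, or_true, or_false, Pi.zero_apply]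
    rw [fockSign_erase κ _ h2, fockSign_insert κ _ h1, Finset.erase_insert_of_ne hk]
    have : paritySign (precedes κ h k) = -paritySign (precedes κ k h) := by
      have h3 := congrArg paritySign (precedes_add_precedes hκ hk)
      rw [paritySign_add, paritySign_one] at h3
      linear_combination paritySign (precedes κ k h) * h3 -
        paritySign (precedes κ h k) * paritySign_mul_self (precedes κ k h)
    rw [this]
    ring

/-- The number operator. On a vector with coefficients `t ^ (|A| / 2)` it acts as `2 t d/dt`, which
is how the derivative of the Pfaffian enters. -/
theorem sum_create_annihilate [Fintype H] (f : Finset H → ℂ) (A : Finset H) :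
    ∑ h, create κ h (annihilate κ h f) A = A.card * f A := by
  have : ∀ h, create κ h (annihilate κ h f) A = if h ∈ A then f A else 0 := by
    intro h
    unfold create
    split_ifs with h1
    · rw [annihilate, if_neg (Finset.notMem_erase h A), fockSign_erase κ _ h1, precedes_self,
        paritySign_zero, one_mul, ← mul_assoc, fockSign_mul_self, one_mul, Finset.insert_erase h1]
    · rfl
  simp [this]

/-- Listed in increasing order, the signs alternate starting from `1`. -/
theorem sum_fockSign (hκ : κ.Injective) (B : Finset H) :
    ∑ k ∈ B, fockSign κ k B = if Even B.card then 0 else 1 := by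
  induction B using Finset.induction_on_max_value κ with
  | empty => simp
  | insert a s ha hmax ih =>
    have h1 : ∀ k ∈ s, fockSign κ k (insert a s) = fockSign κ k s := fun k hk => by
      rw [fockSign_insert κ _ ha, precedes, if_neg (hmax k hk).not_gt, paritySign_zero, one_mul]
    have h2 : fockSign κ a (insert a s) = (-1) ^ s.card := by
      rw [fockSign_insert κ _ ha, precedes_self, paritySign_zero, one_mul, fockSign,
        ← paritySign_sum_one]
      congr 1
      refine Finset.sum_congr rfl fun k hk => if_pos ?_
      exact lt_of_le_of_ne (hmax k hk) (hκ.ne (by rintro rfl; exact ha hk))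
    rw [Finset.sum_insert ha, Finset.sum_congr rfl h1, ih, h2, Finset.card_insert_of_notMem ha]
    by_cases hs : Even s.card
    · simp [hs, Nat.even_add_one]
    · simp [hs, Nat.even_add_one, (Nat.not_even_iff_odd.1 hs).neg_one_pow]

/-- The sign of the homogeneous antisymmetric weights. -/
noncomputable def orderSign (κ : H → ℕ) (h k : H) : ℂ :=
  if κ h < κ k then 1 else if κ k < κ h then -1 else 0

/-- Expansion along the row `h` of the Pfaffian whose entries above the diagonal are all `1`, which
is again `1`. The weight is `1 - 2 [k < h] - [k = h]`, so only alternating sums over `B` and over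
the part of `B` below `h` occur. -/
theorem sum_orderSign_mul_fockSign (hκ : κ.Injective) (h : H) {B : Finset H} (hB : ¬ Even B.card) :
    ∑ k ∈ B, orderSign κ h k * fockSign κ k B = if h ∈ B then 0 else fockSign κ h B := by
  set L := B.filter fun k => κ k < κ h with hL
  have hLs : ∑ k ∈ L, fockSign κ k B = if Even L.card then 0 else 1 := by
    rw [← sum_fockSign hκ]
    refine Finset.sum_congr rfl fun k hk => ?_
    rw [hL, Finset.mem_filter] at hk
    unfold fockSign
    rw [hL, Finset.sum_filter]
    congr 1
    refine Finset.sum_congr rfl fun l _ => ?_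
    unfold precedes
    split_ifs <;> first | rfl | omega
  have hh : fockSign κ h B = (-1) ^ L.card := by
    rw [← paritySign_sum_one, fockSign, hL, Finset.sum_filter]
    rfl
  have hpt : ∀ k ∈ B, orderSign κ h k * fockSign κ k B =
      fockSign κ k B - 2 * (if κ k < κ h then fockSign κ k B else 0) -
        (if h = k then fockSign κ k B else 0) := by
    intro k _
    unfold orderSign
    rcases eq_or_ne h k with rfl | hk
    · simp
    · have := hκ.ne hk
      split_ifs <;> first | omega | ring
  rw [Finset.sum_congr rfl hpt, Finset.sum_sub_distrib, Finset.sum_sub_distrib, ← Finset.mul_sum,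
    ← Finset.sum_filter, ← hL, hLs, sum_fockSign hκ, if_neg hB, Finset.sum_ite_eq]
  by_cases hs : Even L.card
  · rw [hs.neg_one_pow] at hh
    split_ifs <;> simp [hh]
  · rw [(Nat.not_even_iff_odd.1 hs).neg_one_pow] at hh
    split_ifs <;> simp [hh] <;> norm_num

/-! ### The Gaussian vector of the vertices -/

variable {V : Type*} [DecidableEq V] (vx : H → V)

/-- All vertices are met by an even number of half-edges of `A`. -/
def EvenAt (A : Finset H) : Prop := ∀ x, Even (A.filter fun h => vx h = x).card

open Classical in
/-- The product over the vertices of the fermionic Gaussians with homogeneous weight `t`. -/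
noncomputable def vertexGaussian (t : ℂ) (A : Finset H) : ℂ :=
  if EvenAt vx A then t ^ (A.card / 2) else 0

/-- The homogeneous antisymmetric weights with `t = 1`. -/
noncomputable def orderMatrix (κ : H → ℕ) (vx : H → V) : Matrix H H ℂ :=
  fun h k => if vx h = vx k then orderSign κ h k else 0

variable {vx}

theorem EvenAt.even_card {A : Finset H} (hA : EvenAt vx A) : Even A.card := by
  rw [Finset.card_eq_sum_card_image vx A]
  exact Finset.even_sum _ fun x _ => hA x

theorem evenAt_insert {h : H} {A : Finset H} (hh : h ∉ A) :
    EvenAt vx (insert h A) ↔ ∀ x, (Even (A.filter fun k => vx k = x).card ↔ x ≠ vx h) := by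
  refine forall_congr' fun x => ?_
  rw [Finset.filter_insert]
  rcases eq_or_ne x (vx h) with rfl | hx
  · rw [if_pos rfl, Finset.card_insert_of_notMem (by simp [hh])]
    simp [Nat.even_add_one]
  · rw [if_neg hx.symm]
    simp [hx]

theorem fockSign_eq_mul_fockSign_filter (h : H) (A : Finset H) (p : H → Prop) [DecidablePred p] :
    fockSign κ h A = paritySign (∑ k ∈ A with ¬ p k, precedes κ k h) *
      fockSign κ h (A.filter p) := by
  rw [fockSign, fockSign, ← paritySign_add, add_comm, Finset.sum_filter_add_sum_filter_not]

/-- The defining property of a fermionic Gaussian. By `hlex` the half-edges of a vertex are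
consecutive, so those elsewhere give one common sign to all half-edges at the vertex of `h`, and the
identity reduces to `sum_orderSign_mul_fockSign` at that vertex. -/
theorem annihilate_vertexGaussian [Fintype H] (hκ : κ.Injective)
    (hlex : ∀ h k l, vx h = vx k → vx l ≠ vx h → (κ l < κ h ↔ κ l < κ k)) (t : ℂ) (h : H) :
    annihilate κ h (vertexGaussian vx t) =
      ∑ k, (t * orderMatrix κ vx h k) • create κ k (vertexGaussian vx t) := by
  classical
  funext A
  simp only [Finset.sum_apply, Pi.smul_apply, smul_eq_mul]
  -- `P` says that `A` is odd at the vertex of `h` and even at all others. Both sides vanish unless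
  -- this holds.
  set P : Prop := ∀ x, (Even (A.filter fun k => vx k = x).card ↔ x ≠ vx h) with hP
  have hins : h ∉ A → (EvenAt vx (insert h A) ↔ P) := fun hh => evenAt_insert hh
  have hers : ∀ k ∈ A, vx h = vx k → (EvenAt vx (A.erase k) ↔ P) := by
    intro k hk hv
    have h1 := evenAt_insert (vx := vx) (Finset.notMem_erase k A)
    rw [Finset.insert_erase hk] at h1
    refine forall_congr' fun x => ?_
    have h2 : (A.filter fun l => vx l = x).card =
        ((A.erase k).filter fun l => vx l = x).card + if vx k = x then 1 else 0 := by
      conv_lhs => rw [← Finset.insert_erase hk]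
      rw [Finset.filter_insert]
      split_ifs with h3
      · rw [Finset.card_insert_of_notMem (by simp)]
      · rfl
    rw [h2, hv]
    rcases eq_or_ne x (vx k) with rfl | hx
    · simp [Nat.even_add_one]
    · simp [hx, hx.symm]
  by_cases hp : P
  · have hAx : ¬ Even (A.filter fun k => vx k = vx h).card := by simp [hp (vx h)]
    have hcard : ∃ r, A.card = 2 * r + 1 := by
      obtain ⟨k, hk⟩ : (A.filter fun k => vx k = vx h).Nonempty := by
        rw [Finset.nonempty_iff_ne_empty]
        intro h0
        simp [h0] at hAx
      rw [Finset.mem_filter] at hk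
      have := ((hers k hk.1 hk.2.symm).2 hp).even_card
      rw [Finset.card_erase_of_mem hk.1] at this
      obtain ⟨r, hr⟩ := this
      have := Finset.card_pos.2 ⟨k, hk.1⟩
      exact ⟨r, by omega⟩
    obtain ⟨r, hr⟩ := hcard
    have hterm : ∀ k, t * orderMatrix κ vx h k * create κ k (vertexGaussian vx t) A =
        if k ∈ A.filter (fun k => vx k = vx h) then t ^ (r + 1) *
          paritySign (∑ l ∈ A with ¬ vx l = vx h, precedes κ l h) *
          (orderSign κ h k * fockSign κ k (A.filter fun k => vx k = vx h)) else 0 := by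
      intro k
      unfold create orderMatrix
      by_cases hkA : k ∈ A <;> by_cases hv : vx k = vx h
      · rw [if_pos hkA, if_pos hv.symm, if_pos (by simp [hkA, hv]), vertexGaussian,
          if_pos ((hers k hkA hv.symm).2 hp), Finset.card_erase_of_mem hkA, hr,
          show (2 * r + 1 - 1) / 2 = r by omega,
          fockSign_eq_mul_fockSign_filter k A fun k => vx k = vx h]
        have : ∑ l ∈ A with ¬ vx l = vx h, precedes κ l k =
            ∑ l ∈ A with ¬ vx l = vx h, precedes κ l h := by
          refine Finset.sum_congr rfl fun l hl => ?_
          rw [Finset.mem_filter] at hl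
          simp only [precedes, hlex h k l hv.symm hl.2]
        rw [this]
        ring
      · simp [Ne.symm hv, hv]
      · simp [hkA]
      · simp [hkA]
    rw [Finset.sum_congr rfl fun k _ => hterm k, Finset.sum_ite_mem, Finset.univ_inter,
      ← Finset.mul_sum, sum_orderSign_mul_fockSign hκ h hAx, annihilate]
    by_cases hh : h ∈ A
    · simp [hh]
    · rw [if_neg hh, if_neg (by simp [hh]), vertexGaussian, if_pos ((hins hh).2 hp),
        Finset.card_insert_of_notMem hh, hr, show (2 * r + 1 + 1) / 2 = r + 1 by omega,
        fockSign_eq_mul_fockSign_filter h A fun k => vx k = vx h]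
      ring
  · rw [Finset.sum_eq_zero]
    · unfold annihilate
      split_ifs with hh
      · rfl
      · rw [vertexGaussian, if_neg (by rwa [hins hh]), mul_zero]
    · intro k _
      unfold create orderMatrix
      by_cases hkA : k ∈ A <;> by_cases hv : vx h = vx k
      · rw [vertexGaussian, if_neg (mt (hers k hkA hv).1 hp)]
        simp
      · simp [hv]
      · simp [hkA]
      · simp [hkA]

end Fock

/-! ### The edge functional -/

section EdgeFunctional

open Polynomial (C X)

variable {E : Type*} [Fintype E] [DecidableEq E] (κ : E × Bool → ℕ)

/-- The half-edges of a set of edges. -/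
def halfEdges (S : Finset E) : Finset (E × Bool) := S ×ˢ Finset.univ

/-- The parity of the number of half-edges of `e'` preceding a half-edge of `e`, counted over both
halves of `e`. -/
def crossing (e e' : E) : ZMod 2 := ∑ b, ∑ b', precedes κ (e', b') (e, b)

/-- A bilinear form refining `crossing`, whose diagonal records the orientation of the edges. -/
def halfCrossing (e e' : E) : ZMod 2 :=
  if e = e' then precedes κ (e, false) (e, true)
  else if κ (e, true) < κ (e', true) then crossing κ e e' else 0

/-- The parity of the sign with which a set of edges contributes to the Pfaffian. -/
def crossingParity (S : Finset E) : ZMod 2 := ∑ e ∈ S, ∑ e' ∈ S, halfCrossing κ e e'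

/-- Pairing with the fermionic Gaussian of the edges. -/
noncomputable def edgeFunctional (f : Finset (E × Bool) → ℂ) : ℂ :=
  ∑ S : Finset E, paritySign (crossingParity κ S) * f (halfEdges S)

variable {κ}

theorem crossing_self (hκ : κ.Injective) (e : E) : crossing κ e e = 1 := by
  have := precedes_add_precedes hκ (h := (e, true)) (k := (e, false)) (by simp)
  simp only [crossing, Fintype.sum_bool, precedes_self]
  linear_combination this

theorem crossing_comm (hκ : κ.Injective) (e e' : E) : crossing κ e e' = crossing κ e' e := by
  rcases eq_or_ne e e' with rfl | h
  · rfl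
  · have h1 : ∀ b b', precedes κ (e', b') (e, b) = 1 + precedes κ (e, b) (e', b') := by
      intro b b'
      have := precedes_add_precedes hκ (h := (e', b')) (k := (e, b)) (by simp [h.symm])
      rw [← this, add_assoc, CharTwo.add_self_eq_zero, add_zero]
    simp only [crossing, Fintype.sum_bool, h1]
    have h4 : (4 : ZMod 2) = 0 := rfl
    linear_combination h4

/-- This makes `crossingParity` a quadratic refinement of the crossing form. The diagonal needs a
correction because an edge crosses itself once, while twice anything is zero modulo 2. -/
theorem halfCrossing_add_halfCrossing (hκ : κ.Injective) (e e' : E) :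
    halfCrossing κ e e' + halfCrossing κ e' e = crossing κ e e' + if e = e' then 1 else 0 := by
  rcases eq_or_ne e e' with rfl | h
  · rw [CharTwo.add_self_eq_zero, crossing_self hκ, if_pos rfl]
    rfl
  · have := hκ.ne (show (e, true) ≠ (e', true) by simp [h])
    rw [halfCrossing, halfCrossing, if_neg h, if_neg h.symm, if_neg h, crossing_comm hκ e' e]
    split_ifs <;> first | omega | simp

theorem halfEdges_insert (S : Finset E) (e : E) (b : Bool) :
    halfEdges (insert e S) = insert (e, b) (insert (e, !b) (halfEdges S)) := by
  ext ⟨e', b'⟩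
  simp only [halfEdges, Finset.mem_product, Finset.mem_insert, Finset.mem_univ, and_true, Prod.mk.injEq]
  cases b <;> cases b' <;> simp

theorem mem_halfEdges {S : Finset E} {h : E × Bool} : h ∈ halfEdges S ↔ h.1 ∈ S := by
  simp [halfEdges]

theorem card_halfEdges (S : Finset E) : (halfEdges S).card = 2 * S.card := by
  simp [halfEdges, mul_comm]

theorem crossingParity_insert (hκ : κ.Injective) {S : Finset E} {e : E} (he : e ∉ S) :
    crossingParity κ (insert e S) =
      crossingParity κ S + precedes κ (e, false) (e, true) + ∑ e' ∈ S, crossing κ e e' := by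
  have h1 : ∑ e' ∈ S, crossing κ e e' =
      ∑ e' ∈ S, (halfCrossing κ e e' + halfCrossing κ e' e) := by
    refine Finset.sum_congr rfl fun e' he' => ?_
    rw [halfCrossing_add_halfCrossing hκ, if_neg (by rintro rfl; exact he he'), add_zero]
  have h2 : halfCrossing κ e e = precedes κ (e, false) (e, true) := if_pos rfl
  rw [h1, Finset.sum_add_distrib]
  simp only [crossingParity, Finset.sum_insert he, Finset.sum_add_distrib, h2]
  ring

/-- The sign `1` for outgoing and `-1` for incoming half-edges. -/
def halfSign (b : Bool) : ℂ := if b then 1 else -1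

theorem fockSign_mul_fockSign_halfEdges (e : E) (b : Bool) (S : Finset E) :
    fockSign κ (e, b) (halfEdges S) * fockSign κ (e, !b) (halfEdges S) =
      paritySign (∑ e' ∈ S, crossing κ e e') := by
  rw [fockSign, fockSign, ← paritySign_add, halfEdges, Finset.sum_product, Finset.sum_product,
    ← Finset.sum_add_distrib]
  congr 1
  refine Finset.sum_congr rfl fun e' _ => ?_
  cases b <;> simp [crossing] ; ring

/-- Adding an edge changes the sign by the Jordan-Wigner signs of both its halves. One of them is
absorbed on the left, and the comparison of the two halves leaves the orientation. -/
theorem paritySign_crossingParity_insert (hκ : κ.Injective) {S : Finset E} {e : E} (he : e ∉ S)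
    (b : Bool) :
    paritySign (crossingParity κ (insert e S)) * fockSign κ (e, b) (halfEdges (insert e S)) =
      halfSign b * (paritySign (crossingParity κ S) * fockSign κ (e, !b) (halfEdges S)) := by
  have h1 : (e, !b) ∉ halfEdges S := by simpa [mem_halfEdges] using he
  have h2 : (e, b) ∉ insert (e, !b) (halfEdges S) := by
    simp [mem_halfEdges, he]
  have h3 : paritySign (precedes κ (e, false) (e, true)) * paritySign (precedes κ (e, !b) (e, b)) =
      halfSign b := by
    rw [← paritySign_add]
    cases b
    · have := precedes_add_precedes hκ (h := (e, true)) (k := (e, false)) (by simp)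
      simp only [Bool.not_false, halfSign]
      rw [add_comm, this, paritySign_one]
      simp
    · simp [halfSign, CharTwo.add_self_eq_zero, paritySign_zero]
  rw [crossingParity_insert hκ he, paritySign_add, paritySign_add,
    ← fockSign_mul_fockSign_halfEdges e b, halfEdges_insert S e b, fockSign_insert κ _ h2,
    fockSign_insert κ _ h1, precedes_self, paritySign_zero, one_mul, ← h3]
  linear_combination paritySign (crossingParity κ S) * paritySign (precedes κ (e, false) (e, true)) *
    fockSign κ (e, !b) (halfEdges S) * paritySign (precedes κ (e, !b) (e, b)) *
    fockSign_mul_self κ (e, b) (halfEdges S)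

/-- The Gaussian property of the edge functional: it only sees sets containing both halves of an
edge or neither, so filling one half amounts to emptying the other. The sums are matched by removing
`e` from the set of edges. -/
theorem edgeFunctional_create (hκ : κ.Injective) (e : E) (b : Bool) (f : Finset (E × Bool) → ℂ) :
    edgeFunctional κ (create κ (e, b) f) =
      halfSign b * edgeFunctional κ (annihilate κ (e, !b) f) := by
  unfold edgeFunctional
  have h1 : ∀ S : Finset E, paritySign (crossingParity κ S) * create κ (e, b) f (halfEdges S) =
      if e ∈ S then paritySign (crossingParity κ S) * fockSign κ (e, b) (halfEdges S) *
        f ((halfEdges S).erase (e, b)) else 0 := by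
    intro S
    simp only [create, mem_halfEdges]
    split_ifs <;> ring
  have h2 : ∀ S : Finset E, paritySign (crossingParity κ S) * annihilate κ (e, !b) f (halfEdges S) =
      if e ∉ S then paritySign (crossingParity κ S) * fockSign κ (e, !b) (halfEdges S) *
        f (insert (e, !b) (halfEdges S)) else 0 := by
    intro S
    simp only [annihilate, mem_halfEdges]
    split_ifs <;> ring
  simp only [h1, h2]
  rw [← Finset.sum_filter, ← Finset.sum_filter, Finset.mul_sum]
  refine Finset.sum_bij' (fun S _ => S.erase e) (fun S _ => insert e S) ?_ ?_ ?_ ?_ ?_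
  · intro S _; simp
  · intro S _; simp
  · intro S hS; exact Finset.insert_erase (by simpa using hS)
  · intro S hS; exact Finset.erase_insert (by simpa using hS)
  · intro S hS
    have he : e ∈ S := by simpa using hS
    obtain ⟨S', he', rfl⟩ : ∃ S', e ∉ S' ∧ S = insert e S' :=
      ⟨S.erase e, Finset.notMem_erase e S, (Finset.insert_erase he).symm⟩
    rw [Finset.erase_insert he', paritySign_crossingParity_insert hκ he', halfEdges_insert S' e b,
      Finset.erase_insert (by simp [mem_halfEdges, he'])]
    ring

theorem edgeFunctional_add (f g : Finset (E × Bool) → ℂ) :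
    edgeFunctional κ (f + g) = edgeFunctional κ f + edgeFunctional κ g := by
  simp [edgeFunctional, mul_add, Finset.sum_add_distrib]

theorem edgeFunctional_smul (c : ℂ) (f : Finset (E × Bool) → ℂ) :
    edgeFunctional κ (c • f) = c * edgeFunctional κ f := by
  simp only [edgeFunctional, Finset.mul_sum, Pi.smul_apply, smul_eq_mul]
  exact Finset.sum_congr rfl fun _ _ => by ring

theorem edgeFunctional_sum {ι : Type*} (s : Finset ι) (f : ι → Finset (E × Bool) → ℂ) :
    edgeFunctional κ (∑ i ∈ s, f i) = ∑ i ∈ s, edgeFunctional κ (f i) := by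
  simp only [edgeFunctional, Finset.sum_apply, Finset.mul_sum]
  exact Finset.sum_comm

theorem create_sum_smul {H ι : Type*} [DecidableEq H] (κ : H → ℕ) (h : H) (s : Finset ι) (c : ι → ℂ)
    (f : ι → Finset H → ℂ) :
    create κ h (∑ i ∈ s, c i • f i) = ∑ i ∈ s, c i • create κ h (f i) := by
  funext A
  simp only [create, Finset.sum_apply, Pi.smul_apply, smul_eq_mul]
  split_ifs
  · rw [Finset.mul_sum]
    exact Finset.sum_congr rfl fun _ _ => by ring
  · simp

/-! ### The Pfaffian formula -/

/-- The antisymmetric matrix pairing the two halves of each edge. -/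
def pairingMatrix (E : Type*) [DecidableEq E] : Matrix (E × Bool) (E × Bool) ℂ :=
  fun h k => if k = (h.1, !h.2) then halfSign (!h.2) else 0

variable {V : Type*} [DecidableEq V] {vx : E × Bool → V}

variable (κ vx) in
/-- The two-point function of the half-edges. -/
noncomputable def twoPoint (t : ℂ) : Matrix (E × Bool) (E × Bool) ℂ :=
  fun h k => edgeFunctional κ (create κ h (create κ k (vertexGaussian vx t)))

theorem twoPoint_antisymm (hκ : κ.Injective) (t : ℂ) (h k : E × Bool) :
    twoPoint κ vx t h k = -twoPoint κ vx t k h := by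
  rw [twoPoint, create_create hκ, ← neg_one_smul ℂ, edgeFunctional_smul, twoPoint]
  ring

theorem halfSign_mul_self (b : Bool) : halfSign b * halfSign b = 1 := by
  cases b <;> simp [halfSign]

/-- The Schwinger-Dyson equation for the two-point function. -/
theorem pairingMatrix_sub_mul_twoPoint (hκ : κ.Injective)
    (hlex : ∀ h k l, vx h = vx k → vx l ≠ vx h → (κ l < κ h ↔ κ l < κ k)) (t : ℂ) :
    (pairingMatrix E + (-t) • orderMatrix κ vx) * twoPoint κ vx t =
      edgeFunctional κ (vertexGaussian vx t) • 1 := by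
  ext ⟨e, b⟩ k
  -- The annihilator is rewritten twice: acting on the vertex Gaussian it becomes creators, and
  -- under the edge functional it becomes the creator of the other half. Only two-point functions
  -- remain.
  have h1 := annihilate_create hκ (e, b) k (vertexGaussian vx t)
  rw [annihilate_vertexGaussian hκ hlex, create_sum_smul, sub_eq_add_neg, ← neg_one_smul ℂ] at h1
  have h2 := congrArg (edgeFunctional κ) h1
  rw [edgeFunctional_add, edgeFunctional_smul, edgeFunctional_sum] at h2
  simp only [edgeFunctional_smul] at h2
  have h3 : edgeFunctional κ (annihilate κ (e, b) (create κ k (vertexGaussian vx t))) =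
      halfSign (!b) * twoPoint κ vx t (e, !b) k := by
    have := edgeFunctional_create hκ e (!b) (create κ k (vertexGaussian vx t))
    rw [Bool.not_not] at this
    rw [twoPoint, this, ← mul_assoc, halfSign_mul_self, one_mul]
  have h4 : edgeFunctional κ (if (e, b) = k then vertexGaussian vx t else 0) =
      (edgeFunctional κ (vertexGaussian vx t) • (1 : Matrix (E × Bool) (E × Bool) ℂ)) (e, b) k := by
    rw [Matrix.smul_apply, Matrix.one_apply]
    split_ifs
    · simp
    · simp [edgeFunctional]
  have h5 : ∀ l, edgeFunctional κ (create κ k (create κ l (vertexGaussian vx t))) =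
      -twoPoint κ vx t l k := fun l => twoPoint_antisymm hκ t k l
  rw [h3, h4] at h2
  simp only [h5] at h2
  rw [Matrix.add_mul, Matrix.add_apply, Matrix.mul_apply, Matrix.smul_mul, Matrix.smul_apply,
    Matrix.mul_apply]
  simp only [pairingMatrix, ite_mul, zero_mul, Finset.sum_ite_eq',
    Finset.mem_univ, if_true, smul_eq_mul]
  rw [h2, Finset.mul_sum, Finset.mul_sum, add_assoc, ← Finset.sum_add_distrib]
  simp only [add_eq_left]
  exact Finset.sum_eq_zero fun l _ => by ring

open Classical in
variable (κ vx) in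
/-- The Pfaffian as a sum over even subgraphs. -/
noncomputable def pfaffianPolynomial : Polynomial ℂ :=
  ∑ S : Finset E, if EvenAt vx (halfEdges S) then
    C (paritySign (crossingParity κ S)) * X ^ S.card else 0

theorem edgeFunctional_vertexGaussian (t : ℂ) :
    edgeFunctional κ (vertexGaussian vx t) = (pfaffianPolynomial κ vx).eval t := by
  classical
  rw [pfaffianPolynomial, Polynomial.eval_finsetSum, edgeFunctional]
  refine Finset.sum_congr rfl fun S _ => ?_
  rw [vertexGaussian, card_halfEdges, Nat.mul_div_cancel_left _ two_pos]
  split_ifs <;> simp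

/-- The number operator is evaluated in two ways: by the Gaussian property, and by counting the `2
|S|` half-edges of each term. -/
theorem sum_orderMatrix_mul_twoPoint (hκ : κ.Injective)
    (hlex : ∀ h k l, vx h = vx k → vx l ≠ vx h → (κ l < κ h ↔ κ l < κ k)) (t : ℂ) :
    t * ∑ h, ∑ k, orderMatrix κ vx h k * twoPoint κ vx t h k =
      2 * t * (pfaffianPolynomial κ vx).derivative.eval t := by
  classical
  have h1 : ∑ h, create κ h (annihilate κ h (vertexGaussian vx t)) =
      fun A => (A.card : ℂ) * vertexGaussian vx t A := by
    funext A
    rw [Finset.sum_apply, sum_create_annihilate]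
  have h2 := congrArg (edgeFunctional κ) h1
  simp only [annihilate_vertexGaussian hκ hlex, create_sum_smul, edgeFunctional_sum,
    edgeFunctional_smul] at h2
  rw [Finset.mul_sum]
  simp only [Finset.mul_sum, ← mul_assoc]
  refine h2.trans ?_
  rw [edgeFunctional, pfaffianPolynomial, Polynomial.derivative_sum, Polynomial.eval_finsetSum,
    Finset.mul_sum]
  refine Finset.sum_congr rfl fun S _ => ?_
  rw [vertexGaussian, card_halfEdges, Nat.mul_div_cancel_left _ two_pos]
  split_ifs
  · rcases Nat.eq_zero_or_pos S.card with h0 | h0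
    · simp [h0]
    · obtain ⟨r, hr⟩ := Nat.exists_eq_add_of_le' h0
      simp [hr]
      ring
  · simp

theorem orderMatrix_antisymm (h k : E × Bool) : orderMatrix κ vx h k = -orderMatrix κ vx k h := by
  unfold orderMatrix orderSign
  by_cases hv : vx h = vx k
  · rw [if_pos hv, if_pos hv.symm]
    split_ifs <;> first | omega | simp
  · rw [if_neg hv, if_neg (Ne.symm hv), neg_zero]

theorem det_pairingMatrix : (pairingMatrix E).det = 1 := by
  let M : Matrix Bool Bool ℂ := fun b b' => if b' = !b then halfSign (!b) else 0
  have hM : M.det = 1 := by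
    rw [← Matrix.det_submatrix_equiv_self finTwoEquiv, Matrix.det_fin_two]
    simp only [Matrix.submatrix_apply]
    simp [M, halfSign, finTwoEquiv]
  have h : pairingMatrix E = (Matrix.blockDiagonal fun _ : E => M).submatrix
      (Equiv.prodComm E Bool) (Equiv.prodComm E Bool) := by
    ext ⟨e, b⟩ ⟨e', b'⟩
    rw [Matrix.submatrix_apply, Equiv.prodComm_apply, Equiv.prodComm_apply, Prod.swap_prod_mk,
      Prod.swap_prod_mk, Matrix.blockDiagonal_apply]
    simp only [pairingMatrix, M, Prod.mk.injEq]
    rcases eq_or_ne e e' with rfl | he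
    · simp
    · simp [he, he.symm]
  rw [h, Matrix.det_submatrix_equiv_self, Matrix.det_blockDiagonal]
  simp [hM]

/-- The determinant of an antisymmetric matrix whose vertex blocks are homogeneous is the square
of a signed sum over even subgraphs. -/
theorem det_pairingMatrix_sub (hκ : κ.Injective)
    (hlex : ∀ h k l, vx h = vx k → vx l ≠ vx h → (κ l < κ h ↔ κ l < κ k)) (t : ℂ) :
    (pairingMatrix E + t • -orderMatrix κ vx).det = (pfaffianPolynomial κ vx).eval t ^ 2 := by
  classical
  set q := pfaffianPolynomial κ vx with hq
  set D := ((pairingMatrix E).map C + (X : Polynomial ℂ) • (-orderMatrix κ vx).map C).det with hD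
  have hq0 : q.eval 0 = 1 := by
    rw [hq, ← edgeFunctional_vertexGaussian, edgeFunctional, Finset.sum_eq_single ∅]
    · simp [crossingParity, paritySign_zero, vertexGaussian, halfEdges, EvenAt]
    · intro S _ hS
      rw [vertexGaussian, card_halfEdges, Nat.mul_div_cancel_left _ two_pos,
        zero_pow (by simpa using hS), ite_self, mul_zero]
    · simp
  have hD0 : D.eval 0 = 1 := by
    rw [hD, Matrix.eval_det_map_C_add_X_smul, zero_smul, add_zero, det_pairingMatrix]
  -- Where `q` does not vanish, the Schwinger-Dyson equation exhibits the inverse matrix, and its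
  -- trace against `-O` in Jacobi's formula is `2 q' / q`.
  have hkey : ∀ t, q.eval t ≠ 0 → t ≠ 0 →
      D.derivative.eval t * q.eval t = 2 * D.eval t * q.derivative.eval t := by
    intro t hqt ht
    have hsd := pairingMatrix_sub_mul_twoPoint hκ hlex t
    rw [edgeFunctional_vertexGaussian, ← hq, neg_smul, ← smul_neg] at hsd
    set A := pairingMatrix E + t • -orderMatrix κ vx with hA
    have hAinv : A * ((q.eval t)⁻¹ • twoPoint κ vx t) = 1 := by
      rw [Matrix.mul_smul, hsd, smul_smul, inv_mul_cancel₀ hqt, one_smul]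
    have hdet : A.det ≠ 0 := fun h0 => by
      have := congrArg Matrix.det hAinv
      rw [Matrix.det_mul, h0, zero_mul, Matrix.det_one] at this
      exact zero_ne_one this
    rw [hD, Matrix.eval_derivative_det _ _ _ hdet, Matrix.eval_det_map_C_add_X_smul, ← hA,
      Matrix.inv_eq_right_inv hAinv]
    have htr : Matrix.trace ((q.eval t)⁻¹ • twoPoint κ vx t * -orderMatrix κ vx) =
        (q.eval t)⁻¹ * ∑ h, ∑ k, orderMatrix κ vx h k * twoPoint κ vx t h k := by
      rw [Matrix.smul_mul, Matrix.trace_smul, smul_eq_mul]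
      congr 1
      simp only [Matrix.trace, Matrix.diag, Matrix.mul_apply, Matrix.neg_apply]
      refine Finset.sum_congr rfl fun h _ => Finset.sum_congr rfl fun k _ => ?_
      rw [orderMatrix_antisymm h k]
      ring
    have hs := sum_orderMatrix_mul_twoPoint hκ hlex t
    rw [mul_comm 2 t, mul_assoc] at hs
    rw [htr, mul_left_cancel₀ ht hs, ← hq]
    field_simp
  have hpoly : D.derivative * q = 2 * D * q.derivative := by
    -- The factor `X * q` covers the excluded points. It is a nonzero polynomial and cancels
    -- afterwards.
    have hz : X * q * (D.derivative * q - 2 * D * q.derivative) = 0 := by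
      refine Polynomial.funext fun s => ?_
      simp only [Polynomial.eval_mul, Polynomial.eval_X, Polynomial.eval_sub, Polynomial.eval_ofNat,
        Polynomial.eval_zero]
      by_cases h1 : q.eval s = 0
      · simp [h1]
      by_cases h2 : s = 0
      · simp [h2]
      · rw [hkey s h1 h2, sub_self, mul_zero]
    have hqne : q ≠ 0 := by
      intro h0
      simp [h0] at hq0
    exact sub_eq_zero.1 ((mul_eq_zero.1 hz).resolve_left (mul_ne_zero Polynomial.X_ne_zero hqne))
  rw [← Matrix.eval_det_map_C_add_X_smul, ← hD, Polynomial.eq_sq_of_derivative_mul hpoly hD0 hq0,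
    Polynomial.eval_pow]

end EdgeFunctional

/-! ### Crossing parity and symmetric differences -/

section SymmDiff

variable {E : Type*} [Fintype E] [DecidableEq E] {κ : E × Bool → ℕ}

open scoped symmDiff

theorem Finset.sum_symmDiff_zmod_two (S C : Finset E) (F : E → ZMod 2) :
    ∑ e ∈ S ∆ C, F e = ∑ e ∈ S, F e + ∑ e ∈ C, F e := by
  have h : ∀ A : Finset E, ∑ e ∈ A, F e = ∑ e, if e ∈ A then F e else 0 := fun A => by simp
  rw [h, h S, h C, ← Finset.sum_add_distrib]
  refine Finset.sum_congr rfl fun e _ => ?_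
  by_cases h1 : e ∈ S <;> by_cases h2 : e ∈ C <;>
    simp [Finset.mem_symmDiff, h1, h2, CharTwo.add_self_eq_zero]

theorem Finset.card_symmDiff_add (S C : Finset E) :
    (S ∆ C).card + 2 * (S ∩ C).card = S.card + C.card := by
  have h1 := Finset.card_union_add_card_inter S C
  have h2 : (S ∆ C).card = (S ∪ C).card - (S ∩ C).card := by
    rw [← Finset.card_sdiff_of_subset (Finset.inter_subset_union)]
    congr 1
    exact symmDiff_eq_sup_sdiff_inf S C
  have h3 := Finset.card_le_card (show S ∩ C ⊆ S ∪ C from Finset.inter_subset_union)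
  omega

/-- Polarization of the quadratic refinement; the cardinality of the intersection is the diagonal
correction in `halfCrossing_add_halfCrossing`. -/
theorem crossingParity_symmDiff (hκ : κ.Injective) (S C : Finset E) :
    crossingParity κ (S ∆ C) = crossingParity κ S + crossingParity κ C +
      ∑ e' ∈ C, ∑ e ∈ S, crossing κ e e' + (S ∩ C).card := by
  have h : ∑ e' ∈ C, ∑ e ∈ S, crossing κ e e' + ((S ∩ C).card : ZMod 2) =
      ∑ e ∈ S, ∑ e' ∈ C, halfCrossing κ e e' + ∑ e ∈ C, ∑ e' ∈ S, halfCrossing κ e e' := by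
    have h1 : ((S ∩ C).card : ZMod 2) = ∑ e' ∈ C, ∑ e ∈ S, if e = e' then 1 else 0 := by
      simp [Finset.sum_ite_eq', Finset.inter_comm S C]
    rw [h1, ← Finset.sum_add_distrib, Finset.sum_comm (s := S), ← Finset.sum_add_distrib]
    refine Finset.sum_congr rfl fun e' _ => ?_
    rw [← Finset.sum_add_distrib, ← Finset.sum_add_distrib]
    exact Finset.sum_congr rfl fun e _ => (halfCrossing_add_halfCrossing hκ e e').symm
  rw [add_assoc, h]
  simp only [crossingParity, Finset.sum_symmDiff_zmod_two, Finset.sum_add_distrib]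
  ring

theorem sum_crossing (S : Finset E) (e' : E) :
    ∑ e ∈ S, crossing κ e e' =
      ∑ h ∈ halfEdges S, precedes κ (e', true) h + ∑ h ∈ halfEdges S, precedes κ (e', false) h := by
  rw [halfEdges, Finset.sum_product, Finset.sum_product, ← Finset.sum_add_distrib]
  refine Finset.sum_congr rfl fun e _ => ?_
  simp only [crossing, Fintype.sum_bool]
  ring

theorem evenAt_halfEdges_iff {V : Type*} [DecidableEq V] {vx : E × Bool → V} {S : Finset E} :
    EvenAt vx (halfEdges S) ↔ ∀ x, ∑ e ∈ S, ∑ b, (if vx (e, b) = x then (1 : ZMod 2) else 0) = 0 := by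
  refine forall_congr' fun x => ?_
  rw [← ZMod.natCast_eq_zero_iff_even, Finset.card_eq_sum_ones, Finset.sum_filter, halfEdges,
    Finset.sum_product]
  push_cast
  rfl

theorem EvenAt.symmDiff {V : Type*} [DecidableEq V] {vx : E × Bool → V} {S C : Finset E}
    (hS : EvenAt vx (halfEdges S)) (hC : EvenAt vx (halfEdges C)) :
    EvenAt vx (halfEdges (S ∆ C)) := by
  rw [evenAt_halfEdges_iff] at *
  intro x
  rw [Finset.sum_symmDiff_zmod_two, hS x, hC x, add_zero]

end SymmDiff

/-! ### Ranks on the square lattice -/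

section Lattice

variable {m n : ℕ} (c : LatticeConvention)

/-- Cyclic rank of the direction `d` starting from `a`, counterclockwise if `s = 1` and clockwise if
`s = -1`. -/
def cyclicRank (s a d : ZMod 4) : ℕ := (s * (d - a)).val

theorem cyclicRank_lt (s a d : ZMod 4) : cyclicRank s a d < 4 := ZMod.val_lt _

/-- The sense of the ordering at a vertex. -/
def vertexSense (x : LatticeVertex m n) : ZMod 4 :=
  if IsBlack x then ((c.sense : ℤ) : ZMod 4) else -((c.sense : ℤ) : ZMod 4)

/-- The starting direction of the ordering at a vertex. -/
def vertexStart (x : LatticeVertex m n) : ZMod 4 :=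
  if IsBlack x then c.startBlack else c.startWhite

theorem latticeRank_eq (h : LatticeEdge m n × Bool) :
    latticeRank c h = cyclicRank (vertexSense c (latticeVertexOf c h))
      (vertexStart c (latticeVertexOf c h)) (latticeDirection c h) := by
  unfold latticeRank vertexSense vertexStart cyclicRank
  split_ifs <;> rfl

theorem vertexSense_eq (x : LatticeVertex m n) : vertexSense c x = 1 ∨ vertexSense c x = -1 := by
  unfold vertexSense
  rcases Int.units_eq_one_or c.sense with h | h <;> rw [h] <;> split_ifs <;> decide

/-- Lexicographic position of a vertex. -/
def vertexIndex (x : LatticeVertex m n) : ℕ := x.1.val * (n + 1) + x.2.val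

theorem vertexIndex_injective : Function.Injective (vertexIndex (m := m) (n := n)) := by
  rintro ⟨a, b⟩ ⟨a', b'⟩ h
  simp only [vertexIndex] at h
  have hb : b.val = b'.val := by
    have := congrArg (· % (n + 1)) h
    simpa [Nat.add_mod, Nat.mod_eq_of_lt b.isLt, Nat.mod_eq_of_lt b'.isLt] using this
  have ha : a.val = a'.val := by
    rw [hb] at h
    exact Nat.eq_of_mul_eq_mul_right (Nat.succ_pos n) (Nat.add_right_cancel h)
  exact Prod.ext (Fin.ext ha) (Fin.ext hb)

/-- Lexicographic ordering of the half-edges, first by vertex and then by rank. -/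
def latticeKey (h : LatticeEdge m n × Bool) : ℕ :=
  4 * vertexIndex (latticeVertexOf c h) + latticeRank c h

theorem latticeRank_lt (h : LatticeEdge m n × Bool) : latticeRank c h < 4 := by
  rw [latticeRank_eq]; exact cyclicRank_lt _ _ _

theorem latticeKey_injective : Function.Injective (latticeKey (m := m) (n := n) c) := by
  intro h h' hk
  have h1 := latticeRank_lt c h
  have h2 := latticeRank_lt c h'
  unfold latticeKey at hk
  exact latticeRank_inj c h h' (vertexIndex_injective (by omega)) (by omega)

/-- Ranks are less than `4`, so the multiple of `4` keeps the half-edges of a vertex consecutive, as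
`annihilate_vertexGaussian` requires. -/
theorem latticeKey_lt_iff (h k l : LatticeEdge m n × Bool)
    (hv : latticeVertexOf c h = latticeVertexOf c k)
    (hl : latticeVertexOf c l ≠ latticeVertexOf c h) :
    latticeKey c l < latticeKey c h ↔ latticeKey c l < latticeKey c k := by
  have h1 := latticeRank_lt c h
  have h2 := latticeRank_lt c k
  have h3 := latticeRank_lt c l
  have h4 := vertexIndex_injective.ne hl
  unfold latticeKey
  rw [← hv]
  omega

/-! ### Half-edges determined by their vertex and direction -/

theorem eq_of_vertex_of_direction {h h' : LatticeEdge m n × Bool}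
    (hv : latticeVertexOf c h = latticeVertexOf c h')
    (hd : latticeDirection c h = latticeDirection c h') : h = h' :=
  latticeRank_inj c h h' hv (by rw [latticeRank_eq, latticeRank_eq, hv, hd])

/-- The half of an edge at its lower end. -/
def lowerHalf (e : LatticeEdge m n) : LatticeEdge m n × Bool := (e, lowerIsSource c e)

/-- The half of an edge at its upper end. -/
def upperHalf (e : LatticeEdge m n) : LatticeEdge m n × Bool := (e, !lowerIsSource c e)

theorem latticeVertexOf_lowerHalf (e : LatticeEdge m n) :
    latticeVertexOf c (lowerHalf c e) = lowerEnd e := by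
  simp [latticeVertexOf, lowerHalf]

theorem latticeVertexOf_upperHalf (e : LatticeEdge m n) :
    latticeVertexOf c (upperHalf c e) = upperEnd e := by
  simp [latticeVertexOf, upperHalf]

theorem latticeDirection_lowerHalf (e : LatticeEdge m n) :
    latticeDirection c (lowerHalf c e) = edgeDirection e := by
  simp [latticeDirection, lowerHalf]

theorem latticeDirection_upperHalf (e : LatticeEdge m n) :
    latticeDirection c (upperHalf c e) = edgeDirection e + 2 := by
  simp [latticeDirection, upperHalf]

theorem eq_lowerHalf_or_eq_upperHalf (h : LatticeEdge m n × Bool) :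
    h = lowerHalf c h.1 ∨ h = upperHalf c h.1 := by
  obtain ⟨e, b⟩ := h
  unfold lowerHalf upperHalf
  cases b <;> cases lowerIsSource c e <;> simp

theorem sum_halves {M : Type*} [AddCommMonoid M] (e : LatticeEdge m n)
    (F : LatticeEdge m n × Bool → M) :
    F (e, true) + F (e, false) = F (lowerHalf c e) + F (upperHalf c e) := by
  unfold lowerHalf upperHalf
  cases lowerIsSource c e
  · exact add_comm _ _
  · rfl

/-- The parity of the number of half-edges of `S` leaving `x` in direction `d`. -/
def directionParity (S : Finset (LatticeEdge m n)) (x : LatticeVertex m n) (d : ZMod 4) : ZMod 2 :=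
  ∑ h ∈ halfEdges S with latticeVertexOf c h = x ∧ latticeDirection c h = d, 1

theorem directionParity_of_half (S : Finset (LatticeEdge m n)) (h : LatticeEdge m n × Bool) :
    directionParity c S (latticeVertexOf c h) (latticeDirection c h) = if h.1 ∈ S then 1 else 0 := by
  have : ∀ k, (latticeVertexOf c k = latticeVertexOf c h ∧
      latticeDirection c k = latticeDirection c h) ↔ k = h :=
    fun k => ⟨fun hk => eq_of_vertex_of_direction c hk.1 hk.2, by rintro rfl; simp⟩
  simp only [directionParity, this, Finset.filter_eq', mem_halfEdges]
  split_ifs <;> simp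

theorem directionParity_lowerEnd (S : Finset (LatticeEdge m n)) (e : LatticeEdge m n) :
    directionParity c S (lowerEnd e) (edgeDirection e) = if e ∈ S then 1 else 0 := by
  rw [← latticeVertexOf_lowerHalf c, ← latticeDirection_lowerHalf c, directionParity_of_half]
  rfl

theorem sum_directionParity (S : Finset (LatticeEdge m n)) (x : LatticeVertex m n)
    (F : ZMod 4 → ZMod 2) :
    ∑ h ∈ halfEdges S with latticeVertexOf c h = x, F (latticeDirection c h) =
      ∑ d, directionParity c S x d * F d := by
  rw [← Finset.sum_fiberwise (s := (halfEdges S).filter fun h => latticeVertexOf c h = x)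
    (g := latticeDirection c)]
  refine Finset.sum_congr rfl fun d _ => ?_
  rw [directionParity, Finset.sum_mul, Finset.filter_filter]
  refine Finset.sum_congr rfl fun h hh => ?_
  rw [one_mul, (Finset.mem_filter.1 hh).2.2]

variable {c} in
theorem sum_directionParity_eq_zero {S : Finset (LatticeEdge m n)}
    (hS : EvenAt (latticeVertexOf c) (halfEdges S)) (x : LatticeVertex m n) :
    ∑ d, directionParity c S x d = 0 := by
  have := sum_directionParity c S x 1
  simp only [Pi.one_apply, mul_one] at this
  rw [← this, ← (ZMod.natCast_eq_zero_iff_even).2 (hS x)]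
  simp

variable {c} in
-- All half-edges at another vertex compare with `k` in the same way and are even in number, so
-- modulo 2 only the vertex of `k` counts.
theorem sum_precedes {S : Finset (LatticeEdge m n)}
    (hS : EvenAt (latticeVertexOf c) (halfEdges S)) (k : LatticeEdge m n × Bool) :
    ∑ h ∈ halfEdges S, precedes (latticeKey c) k h =
      ∑ d, directionParity c S (latticeVertexOf c k) d *
        if cyclicRank (vertexSense c (latticeVertexOf c k)) (vertexStart c (latticeVertexOf c k))
          (latticeDirection c k) < cyclicRank (vertexSense c (latticeVertexOf c k))
          (vertexStart c (latticeVertexOf c k)) d then 1 else 0 := by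
  rw [← sum_directionParity c S (latticeVertexOf c k) fun d =>
    if cyclicRank (vertexSense c (latticeVertexOf c k)) (vertexStart c (latticeVertexOf c k))
      (latticeDirection c k) < cyclicRank (vertexSense c (latticeVertexOf c k))
      (vertexStart c (latticeVertexOf c k)) d then 1 else 0,
    ← Finset.sum_fiberwise (s := halfEdges S) (g := latticeVertexOf c),
    Finset.sum_eq_single (latticeVertexOf c k)]
  · refine Finset.sum_congr rfl fun h hh => ?_
    have hv := (Finset.mem_filter.1 hh).2
    rw [precedes, latticeKey, latticeKey, hv, latticeRank_eq, latticeRank_eq, hv]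
    simp only [add_lt_add_iff_left]
  · intro x _ hx
    have h1 : ∀ h ∈ (halfEdges S).filter (fun h => latticeVertexOf c h = x),
        precedes (latticeKey c) k h =
          if vertexIndex (latticeVertexOf c k) < vertexIndex x then 1 else 0 := by
      intro h hh
      have hv := (Finset.mem_filter.1 hh).2
      have h2 := vertexIndex_injective.ne hx
      have h3 := latticeRank_lt c h
      have h4 := latticeRank_lt c k
      rw [precedes, latticeKey, latticeKey, hv]
      split_ifs <;> first | rfl | omega
    rw [Finset.sum_congr rfl h1, Finset.sum_const, nsmul_eq_mul,
      (ZMod.natCast_eq_zero_iff_even).2 (hS x), zero_mul]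
  · simp

/-- In a counterclockwise order, the directions after `d` and those after `d + 1` differ by `d + 1`
alone. If the order starts at `d + 1`, the difference is everything except `d + 1`, which has the
same sum because the total is zero. The clockwise order exchanges the two directions. -/
theorem corner_sum (u : ZMod 4 → ZMod 2) (hu : ∑ d, u d = 0) (a d : ZMod 4) :
    (∑ d', u d' * (if cyclicRank 1 a d < cyclicRank 1 a d' then 1 else 0) +
      ∑ d', u d' * (if cyclicRank 1 a (d + 1) < cyclicRank 1 a d' then 1 else 0) = u (d + 1)) ∧
    (∑ d', u d' * (if cyclicRank (-1) a d < cyclicRank (-1) a d' then 1 else 0) +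
      ∑ d', u d' * (if cyclicRank (-1) a (d + 1) < cyclicRank (-1) a d' then 1 else 0) = u d) := by
  revert u
  revert a d
  decide +kernel

end Lattice

/-! ### Faces of the square lattice -/

section Faces

open scoped symmDiff

variable {m n : ℕ} {c : LatticeConvention}

/-- The lower edge of a face. -/
def bottomEdge (i : Fin m) (j : Fin n) : LatticeEdge m n := Sum.inl (i, j.castSucc)
/-- The upper edge of a face. -/
def topEdge (i : Fin m) (j : Fin n) : LatticeEdge m n := Sum.inl (i, j.succ)
/-- The left edge of a face. -/
def leftEdge (i : Fin m) (j : Fin n) : LatticeEdge m n := Sum.inr (i.castSucc, j)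
/-- The right edge of a face. -/
def rightEdge (i : Fin m) (j : Fin n) : LatticeEdge m n := Sum.inr (i.succ, j)

/-- The boundary of a face. -/
def faceBoundary (i : Fin m) (j : Fin n) : Finset (LatticeEdge m n) :=
  {bottomEdge i j, topEdge i j, leftEdge i j, rightEdge i j}

theorem sum_faceBoundary {M : Type*} [AddCommMonoid M] (i : Fin m) (j : Fin n)
    (F : LatticeEdge m n → M) : ∑ e ∈ faceBoundary i j, F e =
      F (bottomEdge i j) + (F (topEdge i j) + (F (leftEdge i j) + F (rightEdge i j))) := by
  rw [faceBoundary, Finset.sum_insert, Finset.sum_insert, Finset.sum_insert, Finset.sum_singleton] <;>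
    simp [bottomEdge, topEdge, leftEdge, rightEdge, Fin.ext_iff]

theorem card_faceBoundary (i : Fin m) (j : Fin n) : (faceBoundary i j).card = 4 := by
  rw [Finset.card_eq_sum_ones, sum_faceBoundary]
  rfl

theorem isBlack_lowerRight (i : Fin m) (j : Fin n) :
    IsBlack (i.succ, j.castSucc) ↔ ¬ IsBlack (i.castSucc, j.castSucc) := by
  simp only [IsBlack, Fin.val_succ, Fin.val_castSucc, Nat.even_add, Nat.even_add_one]
  tauto

theorem isBlack_upperLeft (i : Fin m) (j : Fin n) :
    IsBlack (i.castSucc, j.succ) ↔ ¬ IsBlack (i.castSucc, j.castSucc) := by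
  simp only [IsBlack, Fin.val_succ, Fin.val_castSucc, Nat.even_add, Nat.even_add_one]
  tauto

theorem isBlack_upperRight (i : Fin m) (j : Fin n) :
    IsBlack (i.succ, j.succ) ↔ IsBlack (i.castSucc, j.castSucc) := by
  simp only [IsBlack, Fin.val_succ, Fin.val_castSucc, Nat.even_add, Nat.even_add_one]
  tauto

theorem evenAt_faceBoundary (i : Fin m) (j : Fin n) :
    EvenAt (latticeVertexOf c) (halfEdges (faceBoundary i j)) := by
  rw [evenAt_halfEdges_iff]
  intro x
  set δ : LatticeVertex m n → ZMod 2 := fun y => if y = x then 1 else 0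
  change ∑ e ∈ faceBoundary i j, ∑ b, δ (latticeVertexOf c (e, b)) = 0
  simp only [Fintype.sum_bool, sum_halves c _ fun h => δ (latticeVertexOf c h),
    latticeVertexOf_lowerHalf, latticeVertexOf_upperHalf, sum_faceBoundary]
  simp only [bottomEdge, topEdge, leftEdge, rightEdge, lowerEnd, upperEnd]
  linear_combination CharTwo.add_self_eq_zero (δ (i.castSucc, j.castSucc)) +
    CharTwo.add_self_eq_zero (δ (i.succ, j.castSucc)) +
    CharTwo.add_self_eq_zero (δ (i.castSucc, j.succ)) + CharTwo.add_self_eq_zero (δ (i.succ, j.succ))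

/-- The indicator of a set of edges. -/
def edgeIndicator (S : Finset (LatticeEdge m n)) (e : LatticeEdge m n) : ZMod 2 :=
  if e ∈ S then 1 else 0

/-- The corner of two consecutive half-edges of a face contributes one edge, according to the sense
of the ordering. -/
theorem sum_precedes_corner {S : Finset (LatticeEdge m n)}
    (hS : EvenAt (latticeVertexOf c) (halfEdges S)) {h k : LatticeEdge m n × Bool}
    (hv : latticeVertexOf c k = latticeVertexOf c h)
    (hd : latticeDirection c k = latticeDirection c h + 1) :
    ∑ l ∈ halfEdges S, precedes (latticeKey c) h l + ∑ l ∈ halfEdges S, precedes (latticeKey c) k l =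
      if vertexSense c (latticeVertexOf c h) = 1 then edgeIndicator S k.1
      else edgeIndicator S h.1 := by
  rw [edgeIndicator, edgeIndicator, ← directionParity_of_half c, ← directionParity_of_half c, sum_precedes hS, sum_precedes hS, hd, hv]
  have hc := corner_sum (directionParity c S (latticeVertexOf c h))
    (sum_directionParity_eq_zero hS _) (vertexStart c (latticeVertexOf c h)) (latticeDirection c h)
  rcases vertexSense_eq c (latticeVertexOf c h) with hs | hs
  · rw [hs, if_pos rfl]; exact hc.1
  · rw [hs, if_neg (by decide)]; exact hc.2

theorem vertexSense_eq_one_iff_not {x y : LatticeVertex m n} (h : IsBlack x ↔ ¬ IsBlack y) :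
    vertexSense c x = 1 ↔ ¬ vertexSense c y = 1 := by
  unfold vertexSense
  rcases Int.units_eq_one_or c.sense with hs | hs <;> rw [hs] <;> by_cases hy : IsBlack y <;>
    simp only [h, hy, not_true, not_false_eq_true, if_true, if_false] <;> decide

/-- Each corner of the face contributes one of its two face edges, chosen by the sense at that
corner. The senses alternate around the face, so the choices are either the left and right edges
twice each, or the bottom and top edges twice each, and they cancel modulo 2. -/
theorem sum_crossing_faceBoundary {S : Finset (LatticeEdge m n)}
    (hS : EvenAt (latticeVertexOf c) (halfEdges S)) (i : Fin m) (j : Fin n) :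
    ∑ e' ∈ faceBoundary i j, ∑ e ∈ S, crossing (latticeKey c) e e' = 0 := by
  simp only [sum_crossing,
    sum_halves c _ fun k => ∑ h ∈ halfEdges S, precedes (latticeKey c) k h, sum_faceBoundary]
  have h1 := sum_precedes_corner hS (h := lowerHalf c (bottomEdge i j)) (k := lowerHalf c (leftEdge i j))
    (by simp only [latticeVertexOf_lowerHalf]; rfl)
    (by simp only [latticeDirection_lowerHalf, edgeDirection, bottomEdge, leftEdge]; decide)
  have h2 := sum_precedes_corner hS (h := lowerHalf c (rightEdge i j)) (k := upperHalf c (bottomEdge i j))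
    (by simp only [latticeVertexOf_lowerHalf, latticeVertexOf_upperHalf]; rfl)
    (by simp only [latticeDirection_lowerHalf, latticeDirection_upperHalf, edgeDirection, bottomEdge,
          rightEdge]; decide)
  have h3 := sum_precedes_corner hS (h := upperHalf c (topEdge i j)) (k := upperHalf c (rightEdge i j))
    (by simp only [latticeVertexOf_upperHalf]; rfl)
    (by simp only [latticeDirection_upperHalf, edgeDirection, topEdge, rightEdge]; decide)
  have h4 := sum_precedes_corner hS (h := upperHalf c (leftEdge i j)) (k := lowerHalf c (topEdge i j))
    (by simp only [latticeVertexOf_lowerHalf, latticeVertexOf_upperHalf]; rfl)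
    (by simp only [latticeDirection_lowerHalf, latticeDirection_upperHalf, edgeDirection, topEdge,
          leftEdge]; decide)
  simp only [latticeVertexOf_lowerHalf, latticeVertexOf_upperHalf] at h1 h2 h3 h4
  have s1 : lowerEnd (bottomEdge i j) = (i.castSucc, j.castSucc) := rfl
  have s2 : lowerEnd (rightEdge i j) = (i.succ, j.castSucc) := rfl
  have s3 : upperEnd (topEdge i j) = (i.succ, j.succ) := rfl
  have s4 : upperEnd (leftEdge i j) = (i.castSucc, j.succ) := rfl
  have t2 := vertexSense_eq_one_iff_not (c := c) (isBlack_lowerRight i j)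
  have t3 := vertexSense_eq_one_iff_not (c := c) (x := (i.castSucc, j.succ)) (y := (i.succ, j.succ))
    (by rw [isBlack_upperLeft, isBlack_upperRight])
  have t4 := vertexSense_eq_one_iff_not (c := c) (isBlack_upperLeft i j)
  rw [s1] at h1
  rw [s2] at h2
  rw [s3] at h3
  rw [s4] at h4
  simp only [lowerHalf, upperHalf] at h1 h2 h3 h4 ⊢
  by_cases hb : vertexSense c ((i.castSucc, j.castSucc) : LatticeVertex m n) = 1
  · rw [if_pos hb] at h1
    rw [if_neg (by tauto)] at h2
    rw [if_pos (by tauto)] at h3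
    rw [if_neg (by tauto)] at h4
    linear_combination h1 + h2 + h3 + h4 + CharTwo.add_self_eq_zero
      (edgeIndicator S (leftEdge i j)) + CharTwo.add_self_eq_zero
      (edgeIndicator S (rightEdge i j))
  · rw [if_neg hb] at h1
    rw [if_pos (by tauto)] at h2
    rw [if_neg (by tauto)] at h3
    rw [if_pos (by tauto)] at h4
    linear_combination h1 + h2 + h3 + h4 + CharTwo.add_self_eq_zero
      (edgeIndicator S (bottomEdge i j)) + CharTwo.add_self_eq_zero
      (edgeIndicator S (topEdge i j))

/-! ### The sign of a face boundary -/

theorem vertexSense_of_isBlack_iff_not {x y : LatticeVertex m n} (h : IsBlack x ↔ ¬ IsBlack y) :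
    vertexSense c x = -vertexSense c y := by
  unfold vertexSense
  by_cases hy : IsBlack y <;> simp [h, hy]

theorem vertexStart_of_isBlack_iff_not {x y : LatticeVertex m n} (h : IsBlack x ↔ ¬ IsBlack y) :
    vertexStart c x = vertexStart c y + 1 ∨ vertexStart c x = vertexStart c y - 1 := by
  have hp : c.startBlack = c.startWhite + 1 ∨ c.startBlack = c.startWhite - 1 := by
    rcases c.perpendicular with hp | hp <;> rw [hp] <;> simp
  unfold vertexStart
  by_cases hy : IsBlack y <;> simp only [h, hy, not_true, not_false_eq_true, if_true, if_false]
  · exact c.perpendicular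
  · exact hp

theorem crossing_eq (e e' : LatticeEdge m n) :
    crossing (latticeKey c) e e' =
      precedes (latticeKey c) (lowerHalf c e') (lowerHalf c e) +
      precedes (latticeKey c) (upperHalf c e') (lowerHalf c e) +
      (precedes (latticeKey c) (lowerHalf c e') (upperHalf c e) +
      precedes (latticeKey c) (upperHalf c e') (upperHalf c e)) := by
  simp only [crossing, Fintype.sum_bool]
  rw [sum_halves c e' fun k => precedes (latticeKey c) k (e, true),
    sum_halves c e' fun k => precedes (latticeKey c) k (e, false),
    sum_halves c e fun h => precedes (latticeKey c) (lowerHalf c e') h +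
      precedes (latticeKey c) (upperHalf c e') h]

theorem precedes_of_vertexIndex_lt {h k : LatticeEdge m n × Bool}
    (hlt : vertexIndex (latticeVertexOf c h) < vertexIndex (latticeVertexOf c k)) :
    precedes (latticeKey c) h k = 1 ∧ precedes (latticeKey c) k h = 0 := by
  have h1 := latticeRank_lt c h
  have h2 := latticeRank_lt c k
  unfold precedes latticeKey
  constructor
  · exact if_pos (by omega)
  · exact if_neg (by omega)

theorem precedes_of_vertex_eq {h k : LatticeEdge m n × Bool}
    (hv : latticeVertexOf c h = latticeVertexOf c k) :
    precedes (latticeKey c) h k =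
      if cyclicRank (vertexSense c (latticeVertexOf c h)) (vertexStart c (latticeVertexOf c h))
        (latticeDirection c h) < cyclicRank (vertexSense c (latticeVertexOf c h))
        (vertexStart c (latticeVertexOf c h)) (latticeDirection c k) then 1 else 0 := by
  rw [precedes, latticeKey, latticeKey, latticeRank_eq, latticeRank_eq, hv]
  simp only [add_lt_add_iff_left]

theorem vertexIndex_lowerEnd_lt (e : LatticeEdge m n) :
    vertexIndex (lowerEnd e) < vertexIndex (upperEnd e) := by
  rcases e with ⟨i, j⟩ | ⟨i, j⟩
  · simp only [vertexIndex, lowerEnd, upperEnd, Fin.val_succ, Fin.val_castSucc]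
    nlinarith
  · simp [vertexIndex, lowerEnd, upperEnd]

theorem precedes_false_true (e : LatticeEdge m n) :
    precedes (latticeKey c) (e, false) (e, true) = if lowerIsSource c e then 0 else 1 := by
  have h := precedes_of_vertexIndex_lt (c := c) (h := lowerHalf c e) (k := upperHalf c e)
    (by rw [latticeVertexOf_lowerHalf, latticeVertexOf_upperHalf]; exact vertexIndex_lowerEnd_lt e)
  unfold lowerHalf upperHalf at h
  cases hl : lowerIsSource c e <;> simp_all

/-- Modulo 2, the two corners starting at `a` contribute the parity of `a` if `s = 1` and the
opposite parity if `s = -1`; the other two do the same with `b`. The total is `a + b`, which is odd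
because the starting directions are perpendicular. -/
theorem crossingParity_faceBoundary_aux :
    ∀ s a b : ZMod 4, (s = 1 ∨ s = -1) → (b = a + 1 ∨ b = a - 1) →
      (if cyclicRank s a 1 < cyclicRank s a 0 then (1 : ZMod 2) else 0) +
      (if cyclicRank (-s) b 3 < cyclicRank (-s) b 0 then (1 : ZMod 2) else 0) +
      (if cyclicRank (-s) b 1 < cyclicRank (-s) b 2 then (1 : ZMod 2) else 0) +
      (if cyclicRank s a 3 < cyclicRank s a 2 then (1 : ZMod 2) else 0) = 1 := by
  decide +kernel

theorem crossingParity_faceBoundary (i : Fin m) (j : Fin n) :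
    crossingParity (latticeKey c) (faceBoundary i j) = 0 := by
  have hκ := latticeKey_injective (m := m) (n := n) c
  have hn : 0 < n := j.pos
  have hbt : bottomEdge i j ∉ ({topEdge i j, leftEdge i j, rightEdge i j} : Finset _) := by
    simp [bottomEdge, topEdge, leftEdge, rightEdge, Fin.ext_iff]
  have htl : topEdge i j ∉ ({leftEdge i j, rightEdge i j} : Finset _) := by
    simp [topEdge, leftEdge, rightEdge]
  have hlr : leftEdge i j ∉ ({rightEdge i j} : Finset _) := by
    simp [leftEdge, rightEdge, Fin.ext_iff]
  have hr : crossingParity (latticeKey c) {rightEdge i j} =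
      precedes (latticeKey c) (rightEdge i j, false) (rightEdge i j, true) := by
    simp [crossingParity, halfCrossing]
  rw [faceBoundary, crossingParity_insert hκ hbt, crossingParity_insert hκ htl,
    crossingParity_insert hκ hlr, hr]
  have v1 : latticeVertexOf c (lowerHalf c (bottomEdge i j)) = (i.castSucc, j.castSucc) :=
    latticeVertexOf_lowerHalf c _
  have v2 : latticeVertexOf c (upperHalf c (bottomEdge i j)) = (i.succ, j.castSucc) :=
    latticeVertexOf_upperHalf c _
  have v3 : latticeVertexOf c (lowerHalf c (topEdge i j)) = (i.castSucc, j.succ) :=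
    latticeVertexOf_lowerHalf c _
  have v4 : latticeVertexOf c (upperHalf c (topEdge i j)) = (i.succ, j.succ) :=
    latticeVertexOf_upperHalf c _
  have v5 : latticeVertexOf c (lowerHalf c (leftEdge i j)) = (i.castSucc, j.castSucc) :=
    latticeVertexOf_lowerHalf c _
  have v6 : latticeVertexOf c (upperHalf c (leftEdge i j)) = (i.castSucc, j.succ) :=
    latticeVertexOf_upperHalf c _
  have v7 : latticeVertexOf c (lowerHalf c (rightEdge i j)) = (i.succ, j.castSucc) :=
    latticeVertexOf_lowerHalf c _
  have v8 : latticeVertexOf c (upperHalf c (rightEdge i j)) = (i.succ, j.succ) :=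
    latticeVertexOf_upperHalf c _
  have d1 : latticeDirection c (lowerHalf c (bottomEdge i j)) = 0 := latticeDirection_lowerHalf c _
  have d2 : latticeDirection c (upperHalf c (bottomEdge i j)) = 2 := latticeDirection_upperHalf c _
  have d3 : latticeDirection c (lowerHalf c (topEdge i j)) = 0 := latticeDirection_lowerHalf c _
  have d4 : latticeDirection c (upperHalf c (topEdge i j)) = 2 := latticeDirection_upperHalf c _
  have d5 : latticeDirection c (lowerHalf c (leftEdge i j)) = 1 := latticeDirection_lowerHalf c _
  have d6 : latticeDirection c (upperHalf c (leftEdge i j)) = 3 := latticeDirection_upperHalf c _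
  have d7 : latticeDirection c (lowerHalf c (rightEdge i j)) = 1 := latticeDirection_lowerHalf c _
  have d8 : latticeDirection c (upperHalf c (rightEdge i j)) = 3 := latticeDirection_upperHalf c _
  -- The corners come in the order lower left, upper left, lower right, upper right. This settles
  -- all comparisons between different corners; only the four comparisons within a corner depend on
  -- the convention.
  have i1 : vertexIndex ((i.castSucc, j.castSucc) : LatticeVertex m n) <
      vertexIndex ((i.castSucc, j.succ) : LatticeVertex m n) := by simp [vertexIndex]
  have i2 : vertexIndex ((i.castSucc, j.succ) : LatticeVertex m n) <
      vertexIndex ((i.succ, j.castSucc) : LatticeVertex m n) := by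
    simp only [vertexIndex, Fin.val_succ, Fin.val_castSucc]; nlinarith
  have i3 : vertexIndex ((i.succ, j.castSucc) : LatticeVertex m n) <
      vertexIndex ((i.succ, j.succ) : LatticeVertex m n) := by simp [vertexIndex]
  have hlt : ∀ {x y : LatticeVertex m n}, vertexIndex x < vertexIndex y →
      ∀ {h k : LatticeEdge m n × Bool}, latticeVertexOf c h = x → latticeVertexOf c k = y →
      precedes (latticeKey c) h k = 1 ∧ precedes (latticeKey c) k h = 0 := by
    rintro x y hxy h k rfl rfl
    exact precedes_of_vertexIndex_lt hxy
  have heq : ∀ {x : LatticeVertex m n} {d d' : ZMod 4} {h k : LatticeEdge m n × Bool},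
      latticeVertexOf c h = x → latticeVertexOf c k = x → latticeDirection c h = d →
      latticeDirection c k = d' → precedes (latticeKey c) h k =
        if cyclicRank (vertexSense c x) (vertexStart c x) d <
          cyclicRank (vertexSense c x) (vertexStart c x) d' then 1 else 0 := by
    rintro x d d' h k rfl hk rfl rfl
    exact precedes_of_vertex_eq hk.symm
  have o1 : lowerIsSource c (bottomEdge i j) = lowerIsSource c (leftEdge i j) := rfl
  have o2 : lowerIsSource c (topEdge i j) = !lowerIsSource c (leftEdge i j) := by
    have : decide (IsBlack (lowerEnd (topEdge i j))) = !decide (IsBlack (lowerEnd (leftEdge i j))) := by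
      rw [← decide_not, decide_eq_decide]; exact isBlack_upperLeft i j
    unfold lowerIsSource
    rw [this]
    cases decide (IsBlack (lowerEnd (leftEdge i j))) <;> cases c.outOfBlack <;> rfl
  have o3 : lowerIsSource c (rightEdge i j) = !lowerIsSource c (leftEdge i j) := by
    have : decide (IsBlack (lowerEnd (rightEdge i j))) = !decide (IsBlack (lowerEnd (leftEdge i j))) := by
      rw [← decide_not, decide_eq_decide]; exact isBlack_lowerRight i j
    unfold lowerIsSource
    rw [this]
    cases decide (IsBlack (lowerEnd (leftEdge i j))) <;> cases c.outOfBlack <;> rfl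
  have hs2 := vertexSense_of_isBlack_iff_not (c := c) (isBlack_lowerRight i j)
  have hs4 := vertexSense_of_isBlack_iff_not (c := c) (isBlack_upperLeft i j)
  have hs3 : vertexSense c ((i.succ, j.succ) : LatticeVertex m n) =
      vertexSense c ((i.castSucc, j.castSucc) : LatticeVertex m n) := by
    simp only [vertexSense, isBlack_upperRight]
  have ha4 : vertexStart c ((i.castSucc, j.succ) : LatticeVertex m n) =
      vertexStart c ((i.succ, j.castSucc) : LatticeVertex m n) := by
    simp only [vertexStart, isBlack_upperLeft, isBlack_lowerRight]
  have ha3 : vertexStart c ((i.succ, j.succ) : LatticeVertex m n) =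
      vertexStart c ((i.castSucc, j.castSucc) : LatticeVertex m n) := by
    simp only [vertexStart, isBlack_upperRight]
  have haux := crossingParity_faceBoundary_aux
    (vertexSense c ((i.castSucc, j.castSucc) : LatticeVertex m n))
    (vertexStart c ((i.castSucc, j.castSucc) : LatticeVertex m n))
    (vertexStart c ((i.succ, j.castSucc) : LatticeVertex m n)) (vertexSense_eq c _)
    (vertexStart_of_isBlack_iff_not (isBlack_lowerRight i j))
  have i4 := i1.trans i2
  have i5 := i2.trans i3
  have i6 := i1.trans i5
  simp only [Finset.sum_insert htl, Finset.sum_insert hlr, Finset.sum_singleton,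
    crossing_eq, precedes_false_true, o1, o2, o3,
    (hlt i1 v1 v3).2, (hlt i6 v1 v4).2, (hlt i2 v3 v2).1, (hlt i3 v2 v4).2,
    heq v5 v1 d5 d1, (hlt i1 v1 v6).2, (hlt i4 v5 v2).1, (hlt i2 v6 v2).1,
    (hlt i4 v1 v7).2, (hlt i6 v1 v8).2, heq v7 v2 d7 d2, (hlt i3 v2 v8).2,
    (hlt i1 v5 v3).1, heq v6 v3 d6 d3, (hlt i6 v5 v4).1, (hlt i5 v6 v4).1,
    (hlt i2 v3 v7).2, (hlt i5 v3 v8).2, (hlt i3 v7 v4).1, heq v8 v4 d8 d4,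
    (hlt i4 v5 v7).2, (hlt i6 v5 v8).2, (hlt i2 v6 v7).2, (hlt i5 v6 v8).2,
    hs2, hs3, hs4, ha3, ha4]
  have h2 : (2 : ZMod 2) = 0 := rfl
  cases lowerIsSource c (leftEdge i j)
  · simp only [Bool.not_false, Bool.false_eq_true, if_false, if_true]
    linear_combination haux + 5 * h2
  · simp only [Bool.not_true, Bool.false_eq_true, if_false, if_true]
    linear_combination haux + 5 * h2

end Faces

/-! ### Signs of even subgraphs of the square lattice -/

section EvenSubgraphs

open scoped symmDiff

variable {m n : ℕ} {c : LatticeConvention}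

theorem exists_mem_of_directionParity_ne_zero {S : Finset (LatticeEdge m n)} {x : LatticeVertex m n}
    {d : ZMod 4} (h : directionParity c S x d ≠ 0) :
    ∃ k : LatticeEdge m n × Bool, k.1 ∈ S ∧ latticeVertexOf c k = x ∧ latticeDirection c k = d := by
  obtain ⟨k, hk, -⟩ := Finset.exists_ne_zero_of_sum_ne_zero h
  rw [Finset.mem_filter, mem_halfEdges] at hk
  exact ⟨k, hk.1, hk.2⟩

/-- At its lexicographically first vertex an even subgraph contains two edges of a face. -/
theorem exists_bottomEdge_mem {S : Finset (LatticeEdge m n)}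
    (hS : EvenAt (latticeVertexOf c) (halfEdges S)) (hne : S.Nonempty) :
    ∃ i j, bottomEdge i j ∈ S := by
  -- No edge of `S` can arrive at the first vertex from the left or from below, so only the
  -- directions `0` and `1` can occur there, and evenness forces both.
  obtain ⟨e₀, he₀, hmin⟩ := Finset.exists_min_image S (fun e => vertexIndex (lowerEnd e)) hne
  have hlow : ∀ k : LatticeEdge m n × Bool, k.1 ∈ S → latticeVertexOf c k = lowerEnd e₀ →
      k = lowerHalf c k.1 := by
    intro k hk hv
    refine (eq_lowerHalf_or_eq_upperHalf c k).resolve_right fun hup => ?_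
    rw [hup, latticeVertexOf_upperHalf] at hv
    have h1 := hmin _ hk
    have h2 := vertexIndex_lowerEnd_lt k.1
    rw [hv] at h2
    omega
  have hdir : ∀ d, directionParity c S (lowerEnd e₀) d ≠ 0 →
      ∃ e ∈ S, lowerEnd e = lowerEnd e₀ ∧ edgeDirection e = d := by
    intro d hd
    obtain ⟨k, hk, hv, hkd⟩ := exists_mem_of_directionParity_ne_zero hd
    have := hlow k hk hv
    rw [this, latticeVertexOf_lowerHalf] at hv
    rw [this, latticeDirection_lowerHalf] at hkd
    exact ⟨k.1, hk, hv, hkd⟩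
  have h2 : directionParity c S (lowerEnd e₀) 2 = 0 := by
    by_contra h
    obtain ⟨e, -, -, he⟩ := hdir 2 h
    rcases e with e | e <;> revert he <;> simp only [edgeDirection] <;> decide
  have h3 : directionParity c S (lowerEnd e₀) 3 = 0 := by
    by_contra h
    obtain ⟨e, -, -, he⟩ := hdir 3 h
    rcases e with e | e <;> revert he <;> simp only [edgeDirection] <;> decide
  have hsum := sum_directionParity_eq_zero hS (lowerEnd e₀)
  have hz : (∑ d, directionParity c S (lowerEnd e₀) d) = directionParity c S (lowerEnd e₀) 0 +
      directionParity c S (lowerEnd e₀) 1 + directionParity c S (lowerEnd e₀) 2 +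
      directionParity c S (lowerEnd e₀) 3 := Fin.sum_univ_four _
  rw [hz, h2, h3, add_zero, add_zero] at hsum
  have h01 : directionParity c S (lowerEnd e₀) 0 ≠ 0 ∧ directionParity c S (lowerEnd e₀) 1 ≠ 0 := by
    have he := directionParity_lowerEnd c S e₀
    rw [if_pos he₀] at he
    have hE : edgeDirection e₀ = 0 ∨ edgeDirection e₀ = 1 := by
      rcases e₀ with e | e
      · exact Or.inl rfl
      · exact Or.inr rfl
    rcases hE with hE | hE <;> rw [hE] at he <;> rw [he] at hsum ⊢
    · refine ⟨one_ne_zero, fun h => ?_⟩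
      rw [h] at hsum
      simp at hsum
    · refine ⟨fun h => ?_, one_ne_zero⟩
      rw [h] at hsum
      simp at hsum
  obtain ⟨e, heS, hev, hed⟩ := hdir 0 h01.1
  obtain ⟨e', -, hev', hed'⟩ := hdir 1 h01.2
  rcases e with ⟨i, j⟩ | e
  · rcases e' with e' | ⟨i', j'⟩
    · exact absurd hed' (by simp only [edgeDirection]; decide)
    · have hj : j = j'.castSucc := by
        rw [← hev'] at hev
        exact congrArg Prod.snd hev
      subst hj
      exact ⟨i, j', heS⟩
  · exact absurd hed (by simp only [edgeDirection]; decide)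

/-- A weight on edges that decreases when a face is toggled at its lower edge. -/
def edgeWeight : LatticeEdge m n → ℕ
  | Sum.inl (_, j) => n + 1 - j.val
  | Sum.inr _ => 0

theorem sum_edgeWeight_symmDiff_lt {S : Finset (LatticeEdge m n)} {i : Fin m} {j : Fin n}
    (h : bottomEdge i j ∈ S) :
    ∑ e ∈ S ∆ faceBoundary i j, edgeWeight e < ∑ e ∈ S, edgeWeight e := by
  have hsub : S ∆ faceBoundary i j ⊆
      S.erase (bottomEdge i j) ∪ {topEdge i j, leftEdge i j, rightEdge i j} := by
    intro e he
    simp only [Finset.mem_symmDiff, faceBoundary, Finset.mem_insert, Finset.mem_singleton,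
      Finset.mem_union, Finset.mem_erase] at he ⊢
    by_cases hb : e = bottomEdge i j
    · subst hb; tauto
    · tauto
  have h1 := Finset.sum_le_sum_of_subset (f := edgeWeight) hsub
  have h2 := Finset.sum_union_inter (s₁ := S.erase (bottomEdge i j))
    (s₂ := {topEdge i j, leftEdge i j, rightEdge i j}) (f := edgeWeight)
  have h3 := Finset.add_sum_erase S edgeWeight h
  -- Vertical edges weigh nothing, so toggling replaces the bottom edge by at most the top edge,
  -- which weighs one less.
  have h4 : ∑ e ∈ ({topEdge i j, leftEdge i j, rightEdge i j} : Finset (LatticeEdge m n)),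
      edgeWeight e = n + 1 - (j.val + 1) := by
    rw [Finset.sum_insert (by simp [topEdge, leftEdge, rightEdge]),
      Finset.sum_insert (by simp [leftEdge, rightEdge, Fin.ext_iff])]
    simp [edgeWeight, topEdge, leftEdge, rightEdge]
  have h5 : edgeWeight (bottomEdge i j) = n + 1 - j.val := by
    simp [edgeWeight, bottomEdge]
  have h6 := j.isLt
  omega

/-- An even subgraph has an even number of edges, and half of it gives the parity of its sign. -/
theorem crossingParity_of_evenAt (S : Finset (LatticeEdge m n))
    (hS : EvenAt (latticeVertexOf c) (halfEdges S)) :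
    ∃ r : ℕ, S.card = 2 * r ∧ crossingParity (latticeKey c) S = r := by
  induction hw : ∑ e ∈ S, edgeWeight e using Nat.strong_induction_on generalizing S with
  | _ w ih =>
    rcases S.eq_empty_or_nonempty with rfl | hne
    · exact ⟨0, by simp, by simp [crossingParity]⟩
    · obtain ⟨i, j, hb⟩ := exists_bottomEdge_mem hS hne
      obtain ⟨r, hr, hp⟩ := ih _ (hw ▸ sum_edgeWeight_symmDiff_lt hb) _
        (hS.symmDiff (evenAt_faceBoundary i j)) rfl
      rw [crossingParity_symmDiff (latticeKey_injective c), crossingParity_faceBoundary,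
        sum_crossing_faceBoundary hS] at hp
      have hcard := Finset.card_symmDiff_add S (faceBoundary i j)
      rw [card_faceBoundary] at hcard
      -- From `|S ∆ C| = 2 r` and `|C| = 4`, half of `|S|` is `r + |S ∩ C| - 2`, and the subtraction
      -- does not truncate. Modulo 2 the sign changes by the same `|S ∩ C|`.
      refine ⟨r + (S ∩ faceBoundary i j).card - 2, by omega, ?_⟩
      have h2 : ((r + (S ∩ faceBoundary i j).card - 2 : ℕ) : ZMod 2) + 2 =
          r + (S ∩ faceBoundary i j).card := by
        have : 0 < (S ∩ faceBoundary i j).card := Finset.card_pos.2 ⟨_, Finset.mem_inter.2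
          ⟨hb, by simp [faceBoundary]⟩⟩
        have h3 : r + (S ∩ faceBoundary i j).card - 2 + 2 = r + (S ∩ faceBoundary i j).card := by omega
        exact_mod_cast congrArg (Nat.cast (R := ZMod 2)) h3
      have h20 : (2 : ZMod 2) = 0 := rfl
      rw [h20, add_zero] at h2
      rw [h2, ← hp, add_zero, add_zero, add_assoc, CharTwo.add_self_eq_zero, add_zero]

end EvenSubgraphs

/-! ### The even polynomial -/

section EvenPolynomial

namespace OrderedGraph

variable {V E : Type*} [Fintype V] [DecidableEq V] [Fintype E] [DecidableEq E]

theorem evenPolynomial_eq_sum (Γ : OrderedGraph V E) (v : ℂ) :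
    Γ.evenPolynomial v = ∑ S : Finset E with ∀ x, Even (Γ.valence S x), v ^ S.card := by
  have h : ∀ P, (Γ.numEven P : ℂ) =
      ∑ S : Finset E with ∀ x, Even (Γ.valence S x), if S.card = P then 1 else 0 := by
    intro P
    rw [numEven, Nat.card_eq_fintype_card, Fintype.card_subtype, ← Finset.sum_filter,
      Finset.filter_filter, Finset.sum_const, nsmul_one]
    congr 2
    ext S
    simp [and_comm]
  -- The leading `1` of the polynomial is the contribution of the empty subgraph.
  have h0 : (Γ.numEven 0 : ℂ) = 1 := by
    rw [h, Finset.sum_eq_single ∅]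
    · simp
    · intro S _ hS
      simpa using hS
    · intro h0
      exact absurd (Finset.mem_filter.2 ⟨Finset.mem_univ _, fun x => by simp [valence]⟩) h0
  have h1 : Γ.evenPolynomial v = ∑ P ∈ Finset.range (Fintype.card E + 1), (Γ.numEven P : ℂ) * v ^ P := by
    rw [Finset.sum_range_succ', h0, evenPolynomial, add_comm, pow_zero, mul_one,
      Finset.range_eq_Ico, Finset.sum_Ico_add' (fun P => (Γ.numEven P : ℂ) * v ^ P) 0 _ 1]
    rfl
  rw [h1]
  simp only [h, Finset.sum_mul]
  rw [Finset.sum_comm]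
  refine Finset.sum_congr rfl fun S _ => ?_
  rw [Finset.sum_eq_single S.card]
  · simp
  · intro P _ hP
    simp [hP.symm]
  · intro hP
    exact absurd (Finset.mem_range.2 (Nat.lt_succ_of_le (Finset.card_le_univ S))) hP

theorem evenAt_iff_even_valence (Γ : OrderedGraph V E) (S : Finset E) :
    EvenAt Γ.vertexOf (halfEdges S) ↔ ∀ x, Even (Γ.valence S x) := by
  rw [evenAt_halfEdges_iff]
  refine forall_congr' fun x => ?_
  rw [← ZMod.natCast_eq_zero_iff_even, valence, Nat.cast_add, Finset.card_eq_sum_ones,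
    Finset.card_eq_sum_ones, Finset.sum_filter, Finset.sum_filter, Nat.cast_sum, Nat.cast_sum,
    ← Finset.sum_add_distrib]
  simp only [Fintype.sum_bool, Nat.cast_ite, Nat.cast_one, Nat.cast_zero]
  rfl

end OrderedGraph

variable {m n : ℕ} (c : LatticeConvention)

theorem vertexOf_squareLattice : (squareLattice m n c).vertexOf = latticeVertexOf c :=
  funext fun h => halfEdgeVertex_lattice c h

/-- For `|S| = 2 r` the sign `(-1) ^ r` cancels against `(-I) ^ (2 r)`; this is the purpose of the
imaginary weight. -/
theorem pfaffianPolynomial_eval (v : ℂ) :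
    (pfaffianPolynomial (latticeKey (m := m) (n := n) c) (latticeVertexOf c)).eval (-(I * v)) =
      (squareLattice m n c).evenPolynomial v := by
  classical
  rw [OrderedGraph.evenPolynomial_eq_sum, pfaffianPolynomial, Polynomial.eval_finsetSum,
    Finset.sum_filter]
  refine Finset.sum_congr rfl fun S _ => ?_
  have hiff := (squareLattice m n c).evenAt_iff_even_valence S
  rw [vertexOf_squareLattice] at hiff
  by_cases hS : EvenAt (latticeVertexOf c) (halfEdges S)
  · rw [if_pos hS, if_pos (hiff.1 hS)]
    obtain ⟨r, hr, hp⟩ := crossingParity_of_evenAt S hS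
    rw [hp, hr, paritySign_natCast, Polynomial.eval_C_mul, Polynomial.eval_pow, Polynomial.eval_X,
      (even_two_mul r).neg_pow, mul_pow, pow_mul I, I_sq, ← mul_assoc, ← mul_pow]
    simp
  · rw [if_neg hS, if_neg (mt hiff.2 hS), Polynomial.eval_zero]

end EvenPolynomial

/-! ### The generating functional as a Gaussian integral -/

namespace OrderedGraph

open Matrix
open scoped ComplexOrder

variable {V E : Type*} [Fintype V] [DecidableEq V] [Fintype E] [DecidableEq E]

/-- The first components of the half-edge spinors are real-linear coordinates on the space of
spinors on the edges. -/
noncomputable def halfEdgeCoordinates : (E → Spinor) ≃ₗ[ℝ] (E × Bool → ℂ) where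
  toFun w h := halfEdgeSpinor w h 0
  map_add' w w' := by
    funext ⟨e, b⟩
    cases b <;> simp [halfEdgeSpinor, contragredient]
    ring
  map_smul' r w := by
    funext ⟨e, b⟩
    cases b <;> simp [halfEdgeSpinor, contragredient]
  invFun u e := ![u (e, true), -(starRingEnd ℂ (u (e, false)))]
  left_inv w := by
    funext e i
    fin_cases i <;> simp [halfEdgeSpinor, contragredient]
  right_inv u := by
    funext ⟨e, b⟩
    cases b <;> simp [halfEdgeSpinor, contragredient]

theorem measurableEmbedding_halfEdgeCoordinates :
    MeasurableEmbedding (halfEdgeCoordinates (E := E)) :=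
  (halfEdgeCoordinates (E := E)).toContinuousLinearEquiv.toHomeomorph.measurableEmbedding

/-- Both measures are Haar measures, hence proportional. The constant is left undetermined and is
fixed later by normalization at zero weight. -/
theorem exists_map_halfEdgeCoordinates :
    ∃ r : NNReal, r ≠ 0 ∧ Measure.map (halfEdgeCoordinates (E := E)) volume = (r : ENNReal) • volume := by
  have hS : (volume : Measure Spinor).IsAddHaarMeasure :=
    inferInstanceAs (Measure.pi fun _ => volume).IsAddHaarMeasure
  have hE : (volume : Measure (E → Spinor)).IsAddHaarMeasure :=
    Measure.pi.isAddHaarMeasure fun _ => volume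
  have hH : (Measure.map (halfEdgeCoordinates (E := E)) volume).IsAddHaarMeasure :=
    (halfEdgeCoordinates (E := E)).toContinuousLinearEquiv.isAddHaarMeasure_map _
  have h := Measure.isAddLeftInvariant_eq_smul (Measure.map (halfEdgeCoordinates (E := E)) volume)
    (volume : Measure (E × Bool → ℂ))
  exact ⟨_, (Measure.addHaarScalarFactor_pos_of_isAddHaarMeasure _ _).ne', h⟩

theorem pairingMatrix_mulVec (u : E × Bool → ℂ) (e : E) (b : Bool) :
    (pairingMatrix E *ᵥ u) (e, b) = halfSign (!b) * u (e, !b) := by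
  simp [mulVec, dotProduct, pairingMatrix]

theorem halfEdgeSpinor_one (w : E → Spinor) :
    (fun h => halfEdgeSpinor w h 1) = pairingMatrix E *ᵥ star (halfEdgeCoordinates w) := by
  funext ⟨e, b⟩
  rw [pairingMatrix_mulVec]
  cases b <;> simp [halfEdgeSpinor, contragredient, halfSign, halfEdgeCoordinates]

theorem pairingMatrix_mul_self : pairingMatrix E * pairingMatrix E = -1 := by
  refine Matrix.ext_of_mulVec_single fun k => funext fun ⟨e, b⟩ => ?_
  rw [← mulVec_mulVec, pairingMatrix_mulVec, pairingMatrix_mulVec]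
  cases b <;> simp [halfSign, Matrix.one_apply, Pi.single_apply, neg_ite]

theorem pairingMatrix_transpose : (pairingMatrix E)ᵀ = -pairingMatrix E := by
  ext ⟨e, b⟩ ⟨e', b'⟩
  simp only [Matrix.transpose_apply, Matrix.neg_apply, pairingMatrix, Prod.mk.injEq]
  rcases eq_or_ne e e' with rfl | h
  · cases b <;> cases b' <;> simp [halfSign]
  · simp [h, h.symm]

variable (Γ : OrderedGraph V E)

/-- The matrix of the sesquilinear form in the exponent of the generating functional with
homogeneous weights `t`. -/
noncomputable def exponentMatrix (t : ℂ) : Matrix (E × Bool) (E × Bool) ℂ :=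
  1 - t • (pairingMatrix E * orderMatrix Γ.rank Γ.vertexOf)

theorem dotProduct_exponent (t : ℂ) (u : E × Bool → ℂ) :
    u ⬝ᵥ ((pairingMatrix E + t • orderMatrix Γ.rank Γ.vertexOf) *ᵥ (pairingMatrix E *ᵥ star u)) =
      -(Γ.exponentMatrix t).sesqForm u := by
  have hT : (orderMatrix Γ.rank Γ.vertexOf)ᵀ = -orderMatrix Γ.rank Γ.vertexOf := by
    ext h k
    exact orderMatrix_antisymm k h
  have h : (-(Γ.exponentMatrix t))ᵀ =
      (pairingMatrix E + t • orderMatrix Γ.rank Γ.vertexOf) * pairingMatrix E := by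
    rw [exponentMatrix, Matrix.transpose_neg, Matrix.transpose_sub, Matrix.transpose_smul,
      Matrix.transpose_mul, hT, pairingMatrix_transpose, Matrix.add_mul, pairingMatrix_mul_self,
      neg_mul_neg, Matrix.smul_mul, Matrix.transpose_one, neg_sub, sub_eq_neg_add]
  rw [mulVec_mulVec, ← h, Matrix.mulVec_transpose, dotProduct_comm, ← dotProduct_mulVec,
    Matrix.neg_mulVec, dotProduct_neg, Matrix.sesqForm]

theorem det_exponentMatrix (t : ℂ) :
    (Γ.exponentMatrix t).det = (pairingMatrix E + t • orderMatrix Γ.rank Γ.vertexOf).det := by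
  have h : Γ.exponentMatrix t =
      -pairingMatrix E * (pairingMatrix E + t • orderMatrix Γ.rank Γ.vertexOf) := by
    rw [exponentMatrix, Matrix.mul_add, Matrix.neg_mul, pairingMatrix_mul_self, neg_neg,
      Matrix.mul_smul, Matrix.neg_mul, smul_neg, sub_eq_add_neg]
  rw [h, Matrix.det_mul, ← pairingMatrix_transpose, Matrix.det_transpose, det_pairingMatrix, one_mul]

/-- The Gaussian density is also governed by the pairing matrix, so the whole exponent is one
bilinear expression in the first and second components. -/
theorem sum_norm_sq (w : E → Spinor) :
    (fun h => halfEdgeSpinor w h 0) ⬝ᵥ (pairingMatrix E *ᵥ fun h => halfEdgeSpinor w h 1) =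
      -∑ e, ((‖w e 0‖ ^ 2 + ‖w e 1‖ ^ 2 : ℝ) : ℂ) := by
  rw [dotProduct, Fintype.sum_prod_type, ← Finset.sum_neg_distrib]
  refine Finset.sum_congr rfl fun e _ => ?_
  rw [Fintype.sum_bool, pairingMatrix_mulVec, pairingMatrix_mulVec]
  push_cast
  rw [← Complex.conj_mul', ← Complex.conj_mul']
  simp [halfEdgeSpinor, contragredient, halfSign]
  ring

theorem sum_spinorBracket (t : ℂ) (w : E → Spinor) :
    ∑ x, ∑ p : (E × Bool) × (E × Bool) with
      Γ.vertexOf p.1 = x ∧ Γ.vertexOf p.2 = x ∧ Γ.rank p.1 < Γ.rank p.2,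
        Γ.homogeneousWeight t p.1 p.2 *
          spinorBracket (halfEdgeSpinor w p.1) (halfEdgeSpinor w p.2) =
      (fun h => halfEdgeSpinor w h 0) ⬝ᵥ
        ((t • orderMatrix Γ.rank Γ.vertexOf) *ᵥ fun h => halfEdgeSpinor w h 1) := by
  set a : E × Bool → ℂ := fun h => halfEdgeSpinor w h 0 with ha
  set b : E × Bool → ℂ := fun h => halfEdgeSpinor w h 1 with hb
  set L : E × Bool → E × Bool → ℂ := fun h k =>
    if Γ.vertexOf h = Γ.vertexOf k ∧ Γ.rank h < Γ.rank k then t else 0 with hL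
  have h1 : ∀ x, ∑ p : (E × Bool) × (E × Bool) with
      Γ.vertexOf p.1 = x ∧ Γ.vertexOf p.2 = x ∧ Γ.rank p.1 < Γ.rank p.2,
        Γ.homogeneousWeight t p.1 p.2 *
          spinorBracket (halfEdgeSpinor w p.1) (halfEdgeSpinor w p.2) =
      ∑ p : (E × Bool) × (E × Bool), if Γ.vertexOf p.1 = x then
        L p.1 p.2 * (a p.1 * b p.2 - b p.1 * a p.2) else 0 := by
    intro x
    rw [Finset.sum_filter]
    refine Finset.sum_congr rfl fun p _ => ?_
    by_cases hx : Γ.vertexOf p.1 = x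
    · subst hx
      by_cases h2 : Γ.vertexOf p.2 = Γ.vertexOf p.1 <;> by_cases h3 : Γ.rank p.1 < Γ.rank p.2
      · rw [if_pos ⟨rfl, h2, h3⟩, if_pos rfl, hL]
        simp only [h2, h3, and_self, if_true, homogeneousWeight, spinorBracket, ha, hb]
      · simp [hL, h3]
      · simp [hL, h2, Ne.symm h2]
      · simp [hL, h3]
    · simp [hx]
  rw [Finset.sum_congr rfl fun x _ => h1 x, Finset.sum_comm]
  simp only [Finset.sum_ite_eq, Finset.mem_univ, if_true]
  rw [Fintype.sum_prod_type]
  -- The bracket is antisymmetric, so the sum over increasing pairs becomes a sum over all pairs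
  -- with antisymmetrized weights.
  have h2 : ∑ h, ∑ k, L h k * (a h * b k - b h * a k) =
      ∑ h, ∑ k, (L h k - L k h) * (a h * b k) := by
    have h3 : ∑ h, ∑ k, L h k * (b h * a k) = ∑ h, ∑ k, L k h * (a h * b k) := by
      rw [Finset.sum_comm]
      exact Finset.sum_congr rfl fun h _ => Finset.sum_congr rfl fun k _ => by ring
    simp only [mul_sub, sub_mul, Finset.sum_sub_distrib, h3]
  rw [h2, dotProduct]
  refine Finset.sum_congr rfl fun h _ => ?_
  rw [mulVec, dotProduct, Finset.mul_sum]
  refine Finset.sum_congr rfl fun k _ => ?_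
  have h4 : L h k - L k h = t * orderMatrix Γ.rank Γ.vertexOf h k := by
    simp only [hL, orderMatrix, orderSign]
    by_cases hv : Γ.vertexOf h = Γ.vertexOf k
    · simp only [hv, true_and, if_true]
      split_ifs <;> first | omega | simp
    · simp [hv, Ne.symm hv]
  rw [h4, Matrix.smul_apply, smul_eq_mul]
  ring

theorem generatingIntegrand_eq (t : ℂ) (w : E → Spinor) :
    Γ.generatingIntegrand (Γ.homogeneousWeight t) w =
      ((Real.pi : ℂ) ^ (2 * Fintype.card E))⁻¹ *
        Complex.exp (-(Γ.exponentMatrix t).sesqForm (halfEdgeCoordinates w)) := by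
  rw [← dotProduct_exponent, ← halfEdgeSpinor_one, Matrix.add_mulVec, dotProduct_add,
    show (halfEdgeCoordinates w : E × Bool → ℂ) = fun h => halfEdgeSpinor w h 0 from rfl,
    ← sum_spinorBracket, sum_norm_sq, Complex.exp_add, Complex.exp_sum, ← Finset.sum_neg_distrib,
    Complex.exp_sum, generatingIntegrand, ← mul_assoc]
  congr 1
  simp only [bargmannDensity]
  push_cast
  rw [Finset.prod_mul_distrib, Finset.prod_const, Finset.card_univ, inv_pow, ← pow_mul]

theorem exponentMatrix_zero : Γ.exponentMatrix 0 = 1 := by simp [exponentMatrix]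

/-! ### Convergence and value of the generating functional -/

theorem integrable_generatingIntegrand_iff (t : ℂ) :
    Integrable (Γ.generatingIntegrand (Γ.homogeneousWeight t)) ↔
      (Γ.exponentMatrix t + (Γ.exponentMatrix t)ᴴ).PosDef := by
  obtain ⟨r, hr, hmap⟩ := exists_map_halfEdgeCoordinates (E := E)
  have h0 : ((Real.pi : ℂ) ^ (2 * Fintype.card E))⁻¹ ≠ 0 :=
    inv_ne_zero (pow_ne_zero _ (by exact_mod_cast Real.pi_ne_zero))
  have h1 : Integrable (Γ.generatingIntegrand (Γ.homogeneousWeight t)) ↔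
      Integrable (fun z => Complex.exp (-(Γ.exponentMatrix t).sesqForm z)) := by
    rw [show Γ.generatingIntegrand (Γ.homogeneousWeight t) = _ from
      funext (Γ.generatingIntegrand_eq t), integrable_const_mul_iff h0.isUnit]
    have := measurableEmbedding_halfEdgeCoordinates (E := E) |>.integrable_map_iff
      (μ := volume) (g := fun z => Complex.exp (-(Γ.exponentMatrix t).sesqForm z))
    rw [hmap, integrable_smul_measure (by simpa using hr) ENNReal.coe_ne_top] at this
    exact this.symm
  rw [h1]
  exact ⟨posDef_of_integrable_gaussian, fun h => (gaussian_of_posDef h).1⟩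

theorem integral_spinorDensity : ∫ w : E → Spinor, ∏ e, (bargmannDensity (w e) : ℂ) = 1 := by
  rw [integral_fintype_prod_volume_eq_pow (fun z : Spinor => (bargmannDensity z : ℂ))]
  have h : ∀ z : Spinor, (bargmannDensity z : ℂ) =
      ∏ i, ((Real.pi : ℂ)⁻¹ * Complex.exp (-(1 * (‖z i‖ : ℂ) ^ 2))) := by
    intro z
    rw [Fin.prod_univ_two, bargmannDensity]
    push_cast
    rw [neg_add, Complex.exp_add]
    ring_nf
  simp only [h]
  rw [integral_fintype_prod_volume_eq_pow
    (fun z : ℂ => (Real.pi : ℂ)⁻¹ * Complex.exp (-(1 * (‖z‖ : ℂ) ^ 2))), integral_const_mul,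
    integral_cexp_neg_mul_norm_sq (by simp), div_one,
    inv_mul_cancel₀ (by exact_mod_cast Real.pi_ne_zero), one_pow, one_pow]

/-- The generating functional is the inverse of the determinant of its exponent. -/
theorem generatingIntegral_eq {t : ℂ} (h : (Γ.exponentMatrix t + (Γ.exponentMatrix t)ᴴ).PosDef) :
    (Γ.exponentMatrix t).det ≠ 0 ∧
      Γ.generatingIntegral (Γ.homogeneousWeight t) = ((Γ.exponentMatrix t).det)⁻¹ := by
  obtain ⟨r, hr, hmap⟩ := exists_map_halfEdgeCoordinates (E := E)
  have hpi : (Real.pi : ℂ) ^ (2 * Fintype.card E) ≠ 0 :=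
    pow_ne_zero _ (by exact_mod_cast Real.pi_ne_zero)
  have hint : ∀ s, (Γ.exponentMatrix s + (Γ.exponentMatrix s)ᴴ).PosDef →
      Γ.generatingIntegral (Γ.homogeneousWeight s) = r * ((Γ.exponentMatrix s).det)⁻¹ := by
    intro s hs
    obtain ⟨-, -, hg⟩ := gaussian_of_posDef hs
    have hm := measurableEmbedding_halfEdgeCoordinates (E := E) |>.integral_map
      (μ := volume) (fun z => Complex.exp (-(Γ.exponentMatrix s).sesqForm z))
    rw [hmap, integral_smul_measure, ENNReal.coe_toReal, hg, Fintype.card_prod, Fintype.card_bool, mul_comm _ 2] at hm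
    rw [generatingIntegral]
    simp only [Γ.generatingIntegrand_eq, integral_const_mul, ← hm]
    rw [Complex.real_smul]
    field_simp
  -- At zero weight the integral is the total mass of a probability measure, which forces `r = 1`.
  have h0 := hint 0 (by
    rw [exponentMatrix_zero, conjTranspose_one]
    exact PosDef.one.add PosDef.one)
  have h1 : Γ.generatingIntegral (Γ.homogeneousWeight 0) = 1 := by
    rw [generatingIntegral, ← integral_spinorDensity (E := E)]
    congr 1
    funext w
    have : ∀ x, Γ.vertexFunctional (Γ.homogeneousWeight 0) x w = 1 := fun x => by
      simp [vertexFunctional, homogeneousWeight]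
    simp [generatingIntegrand, this]
  rw [h1, exponentMatrix_zero, Matrix.det_one, inv_one, mul_one] at h0
  refine ⟨(gaussian_of_posDef h).2.1, ?_⟩
  rw [hint t h, ← h0, one_mul]

theorem norm_sesqForm_le (M : Matrix (E × Bool) (E × Bool) ℂ) (u : E × Bool → ℂ) :
    ‖M.sesqForm u‖ ≤ (∑ i, ∑ j, ‖M i j‖) * ∑ i, ‖u i‖ ^ 2 := by
  have h : ∀ i, ‖u i‖ ^ 2 ≤ ∑ k, ‖u k‖ ^ 2 := fun i =>
    Finset.single_le_sum (f := fun k => ‖u k‖ ^ 2) (fun _ _ => sq_nonneg _) (Finset.mem_univ i)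
  rw [sesqForm, dotProduct, Finset.sum_mul]
  refine (norm_sum_le _ _).trans (Finset.sum_le_sum fun i _ => ?_)
  rw [norm_mul, Pi.star_apply, norm_star, mulVec, dotProduct, Finset.sum_mul]
  refine (mul_le_mul_of_nonneg_left (norm_sum_le _ _) (norm_nonneg _)).trans ?_
  rw [Finset.mul_sum]
  refine Finset.sum_le_sum fun j _ => ?_
  rw [norm_mul]
  have h1 : ‖u i‖ * ‖u j‖ ≤ ∑ k, ‖u k‖ ^ 2 := by
    nlinarith [sq_nonneg (‖u i‖ - ‖u j‖), h i, h j]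
  calc ‖u i‖ * (‖M i j‖ * ‖u j‖) = ‖M i j‖ * (‖u i‖ * ‖u j‖) := by ring
    _ ≤ _ := mul_le_mul_of_nonneg_left h1 (norm_nonneg _)

theorem eventually_posDef :
    ∀ᶠ t in 𝓝 (0 : ℂ), (Γ.exponentMatrix t + (Γ.exponentMatrix t)ᴴ).PosDef := by
  set M := pairingMatrix E * orderMatrix Γ.rank Γ.vertexOf with hM
  set K := ∑ i, ∑ j, ‖M i j‖ with hK
  have hcont : Filter.Tendsto (fun t : ℂ => ‖t‖ * K) (𝓝 0) (𝓝 0) := by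
    have : Continuous fun t : ℂ => ‖t‖ * K := by fun_prop
    simpa using this.tendsto 0
  filter_upwards [hcont.eventually_lt_const one_pos] with t ht
  refine PosDef.of_dotProduct_mulVec_pos ?_ fun u hu => ?_
  · rw [Matrix.IsHermitian, conjTranspose_add, conjTranspose_conjTranspose, add_comm]
  · have h1 : star u ⬝ᵥ ((Γ.exponentMatrix t + (Γ.exponentMatrix t)ᴴ) *ᵥ u) =
        ((2 * ((Γ.exponentMatrix t).sesqForm u).re : ℝ) : ℂ) := by
      rw [Matrix.add_mulVec, dotProduct_add]
      change (Γ.exponentMatrix t).sesqForm u + (Γ.exponentMatrix t)ᴴ.sesqForm u = _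
      rw [sesqForm_conjTranspose, Complex.add_conj]
    have h2 : (Γ.exponentMatrix t).sesqForm u = ((∑ i, ‖u i‖ ^ 2 : ℝ) : ℂ) - t * M.sesqForm u := by
      have h3 := sesqForm_diagonal 1 u
      rw [Matrix.diagonal_one'] at h3
      rw [exponentMatrix, sesqForm, Matrix.sub_mulVec, dotProduct_sub, Matrix.smul_mulVec,
        dotProduct_smul, smul_eq_mul]
      congr 1
      refine h3.trans ?_
      simp
    have h4 : 0 < ∑ i, ‖u i‖ ^ 2 := by
      obtain ⟨i, hi⟩ := Function.ne_iff.1 hu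
      refine Finset.sum_pos' (fun _ _ => sq_nonneg _) ⟨i, Finset.mem_univ i, ?_⟩
      have : 0 < ‖u i‖ := norm_pos_iff.2 hi
      positivity
    have h5 : ‖t * M.sesqForm u‖ < ∑ i, ‖u i‖ ^ 2 := by
      rw [norm_mul]
      calc ‖t‖ * ‖M.sesqForm u‖ ≤ ‖t‖ * (K * ∑ i, ‖u i‖ ^ 2) :=
            mul_le_mul_of_nonneg_left (norm_sesqForm_le M u) (norm_nonneg _)
        _ = (‖t‖ * K) * ∑ i, ‖u i‖ ^ 2 := by ring
        _ < 1 * ∑ i, ‖u i‖ ^ 2 := mul_lt_mul_of_pos_right ht h4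
        _ = _ := one_mul _
    have h6 := (Complex.re_le_norm (t * M.sesqForm u)).trans_lt h5
    rw [h1, h2, Complex.sub_re, Complex.ofReal_re]
    exact_mod_cast (by linarith)

end OrderedGraph

/-! ### The Ising partition function -/

namespace OrderedGraph

variable {V E : Type*} [Fintype V] [DecidableEq V] [Fintype E] [DecidableEq E]

theorem exp_mul_sign (K : ℝ) (s : ℤˣ) :
    Real.exp (K * ((s : ℤ) : ℝ)) = Real.cosh K * (1 + Real.tanh K * ((s : ℤ) : ℝ)) := by
  have h := (Real.cosh_pos K).ne'
  rw [Real.tanh_eq_sinh_div_cosh]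
  rcases Int.units_eq_one_or s with rfl | rfl
  · simp only [Units.val_one, Int.cast_one, mul_one]
    rw [mul_add, mul_one, mul_div_cancel₀ _ h, Real.cosh_add_sinh]
  · simp only [Units.val_neg, Units.val_one, Int.cast_neg, Int.cast_one, mul_neg, mul_one]
    rw [mul_add, mul_one, mul_neg, mul_div_cancel₀ _ h, ← sub_eq_add_neg, Real.cosh_sub_sinh]

/-- Each spin occurs to the power of its valence, and the sum over `±1` of an odd power vanishes. -/
theorem sum_prod_spins (Γ : OrderedGraph V E) (S : Finset E) :
    ∑ σ : V → ℤˣ, ∏ e ∈ S, (((σ (Γ.src e) : ℤ) : ℝ) * ((σ (Γ.tgt e) : ℤ) : ℝ)) =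
      if ∀ x, Even (Γ.valence S x) then (2 : ℝ) ^ Fintype.card V else 0 := by
  have h1 : ∀ (σ : V → ℤˣ) (g : E → V), ∏ e ∈ S, ((σ (g e) : ℤ) : ℝ) =
      ∏ x, ((σ x : ℤ) : ℝ) ^ (S.filter fun e => g e = x).card := by
    intro σ g
    rw [← Finset.prod_fiberwise S g]
    refine Finset.prod_congr rfl fun x _ => ?_
    rw [Finset.prod_congr rfl (g := fun _ => ((σ x : ℤ) : ℝ))
      fun e he => by rw [(Finset.mem_filter.1 he).2], Finset.prod_const]
  have h2 : ∀ σ : V → ℤˣ, ∏ e ∈ S, (((σ (Γ.src e) : ℤ) : ℝ) * ((σ (Γ.tgt e) : ℤ) : ℝ)) =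
      ∏ x, ((σ x : ℤ) : ℝ) ^ Γ.valence S x := by
    intro σ
    rw [Finset.prod_mul_distrib, h1, h1, ← Finset.prod_mul_distrib]
    exact Finset.prod_congr rfl fun x _ => (pow_add _ _ _).symm
  have h3 : ∀ k : ℕ, ∑ s : ℤˣ, ((s : ℤ) : ℝ) ^ k = if Even k then 2 else 0 := by
    intro k
    rw [show (Finset.univ : Finset ℤˣ) = {1, -1} from rfl, Finset.sum_pair (by decide)]
    by_cases hk : Even k
    · simp [hk, hk.neg_one_pow]; norm_num
    · simp [hk, (Nat.not_even_iff_odd.1 hk).neg_one_pow]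
  rw [Finset.sum_congr rfl fun σ _ => h2 σ, ← Fintype.piFinset_univ,
    ← Finset.prod_univ_sum (fun _ => Finset.univ) fun x (s : ℤˣ) => ((s : ℤ) : ℝ) ^ Γ.valence S x]
  simp only [h3]
  split_ifs with h
  · rw [Finset.prod_congr rfl fun x _ => if_pos (h x), Finset.prod_const, Finset.card_univ]
  · push Not at h
    obtain ⟨x, hx⟩ := h
    exact Finset.prod_eq_zero (Finset.mem_univ x) (if_neg hx)

/-- The high temperature expansion. -/
theorem isingPartition_eq (Γ : OrderedGraph V E) (β J : ℝ) :
    (Γ.isingPartition β J : ℂ) = (Real.cosh (β * J) : ℂ) ^ Fintype.card E *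
      2 ^ Fintype.card V * Γ.evenPolynomial (Real.tanh (β * J) : ℂ) := by
  set K := β * J
  have h : Γ.isingPartition β J = Real.cosh K ^ Fintype.card E * 2 ^ Fintype.card V *
      ∑ S : Finset E with ∀ x, Even (Γ.valence S x), Real.tanh K ^ S.card := by
    have h1 : ∀ σ : V → ℤˣ,
        Real.exp (K * ∑ e, ((σ (Γ.src e) : ℤ) : ℝ) * ((σ (Γ.tgt e) : ℤ) : ℝ)) =
        Real.cosh K ^ Fintype.card E * ∑ S : Finset E, Real.tanh K ^ S.card *
          ∏ e ∈ S, (((σ (Γ.src e) : ℤ) : ℝ) * ((σ (Γ.tgt e) : ℤ) : ℝ)) := by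
      intro σ
      have h2 : ∀ e, Real.exp (K * (((σ (Γ.src e) : ℤ) : ℝ) * ((σ (Γ.tgt e) : ℤ) : ℝ))) =
          Real.cosh K * (1 + Real.tanh K *
            (((σ (Γ.src e) : ℤ) : ℝ) * ((σ (Γ.tgt e) : ℤ) : ℝ))) := by
        intro e
        have := exp_mul_sign K (σ (Γ.src e) * σ (Γ.tgt e))
        simpa using this
      rw [Finset.mul_sum, Real.exp_sum, Finset.prod_congr rfl fun e _ => h2 e,
        Finset.prod_mul_distrib, Finset.prod_const, Finset.card_univ, Finset.prod_one_add,
        Finset.powerset_univ]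
      simp only [Finset.prod_mul_distrib, Finset.prod_const]
    rw [isingPartition, Finset.sum_congr rfl fun σ _ => h1 σ, ← Finset.mul_sum, Finset.sum_comm,
      mul_assoc, Finset.sum_filter, Finset.mul_sum _ _ ((2 : ℝ) ^ Fintype.card V)]
    congr 1
    refine Finset.sum_congr rfl fun S _ => ?_
    rw [← Finset.mul_sum, sum_prod_spins]
    split_ifs <;> ring
  rw [h, evenPolynomial_eq_sum]
  push_cast
  rfl

theorem isingPartition_pos (Γ : OrderedGraph V E) (β J : ℝ) : 0 < Γ.isingPartition β J :=
  Finset.sum_pos (fun _ _ => Real.exp_pos _) Finset.univ_nonempty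

end OrderedGraph

/-! ### Analytic continuation -/

section Continuation

variable {V E : Type*} [Fintype V] [DecidableEq V] [Fintype E] [DecidableEq E]

open OrderedGraph

theorem OrderedGraph.evenPolynomial_zero (Γ : OrderedGraph V E) : Γ.evenPolynomial 0 = 1 := by
  rw [evenPolynomial, Finset.sum_eq_zero, add_zero]
  intro P hP
  rw [zero_pow (Nat.one_le_iff_ne_zero.1 (Finset.mem_Icc.1 hP).1), mul_zero]

theorem OrderedGraph.differentiable_evenPolynomial (Γ : OrderedGraph V E) :
    Differentiable ℂ Γ.evenPolynomial := by
  unfold evenPolynomial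
  fun_prop

theorem OrderedGraph.finite_zeros_evenPolynomial (Γ : OrderedGraph V E) :
    {v | Γ.evenPolynomial v = 0}.Finite := by
  set p : Polynomial ℂ := 1 + ∑ P ∈ Finset.Icc 1 (Fintype.card E),
    Polynomial.C (Γ.numEven P : ℂ) * Polynomial.X ^ P with hp
  have hev : ∀ v, p.eval v = Γ.evenPolynomial v := by
    intro v
    simp [hp, evenPolynomial, Polynomial.eval_finsetSum]
  have hp0 : p ≠ 0 := by
    intro h0
    have := hev 0
    rw [h0, evenPolynomial_zero, Polynomial.eval_zero] at this
    exact zero_ne_one this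
  refine (Polynomial.finite_setOfPred_isRoot hp0).subset fun v hv => ?_
  rw [Set.mem_ofPred_eq, Polynomial.IsRoot, hev]
  exact hv

/-- If the generating functional is the inverse square of the even polynomial near zero, then so is
its analytic continuation, which exists exactly off the zeros of the polynomial. -/
theorem OrderedGraph.hasGeneratingValue_iff (Γ : OrderedGraph V E)
    (h : ∀ᶠ u in 𝓝 (0 : ℂ), Γ.generatingIntegral (Γ.homogeneousWeight (I * u)) =
      (Γ.evenPolynomial u ^ 2)⁻¹) (v a : ℂ) :
    Γ.HasGeneratingValue v a ↔ Γ.evenPolynomial v ≠ 0 ∧ a = (Γ.evenPolynomial v ^ 2)⁻¹ := by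
  have hcont := Γ.differentiable_evenPolynomial.continuous
  have h0 : ∀ᶠ u in 𝓝 (0 : ℂ), Γ.evenPolynomial u ≠ 0 :=
    hcont.continuousAt.eventually_ne (by rw [evenPolynomial_zero]; exact one_ne_zero)
  constructor
  · rintro ⟨U, F, hU, hpre, h0U, hvU, hF, hFG, rfl⟩
    have hp : AnalyticOnNhd ℂ Γ.evenPolynomial U :=
      (Γ.differentiable_evenPolynomial.differentiableOn).analyticOnNhd hU
    -- The identity theorem is applied to the product, which is analytic even at zeros of the
    -- polynomial. Its constant value `1` then excludes such zeros from `U`.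
    have heq : Set.EqOn (fun u => F u * Γ.evenPolynomial u ^ 2) (fun _ => 1) U := by
      refine AnalyticOnNhd.eqOn_of_preconnected_of_eventuallyEq (hF.mul (hp.pow 2))
        analyticOnNhd_const hpre h0U ?_
      filter_upwards [hFG, h, h0] with u h1 h2 h3
      rw [h1, h2, inv_mul_cancel₀ (pow_ne_zero 2 h3)]
    have hv := heq hvU
    simp only at hv
    have hne : Γ.evenPolynomial v ≠ 0 := by
      intro hz
      rw [hz] at hv
      simp at hv
    exact ⟨hne, eq_inv_of_mul_eq_one_left hv⟩
  · rintro ⟨hv, rfl⟩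
    have hopen : IsOpen {u | Γ.evenPolynomial u ≠ 0} := isOpen_ne_fun hcont continuous_const
    refine ⟨{u | Γ.evenPolynomial u ≠ 0}, fun u => (Γ.evenPolynomial u ^ 2)⁻¹, hopen, ?_, ?_, hv,
      ?_, ?_, rfl⟩
    -- Removing finitely many points leaves the plane connected, so one domain serves for all `v`.
    · exact (Γ.finite_zeros_evenPolynomial.countable.isConnected_compl_of_one_lt_rank
        (by rw [Complex.rank_real_complex]; exact Nat.one_lt_ofNat)).isPreconnected
    · rw [Set.mem_ofPred_eq, evenPolynomial_zero]; exact one_ne_zero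
    · refine DifferentiableOn.analyticOnNhd (fun u hu => ?_) hopen
      exact ((Γ.differentiable_evenPolynomial u).pow 2 |>.inv (pow_ne_zero 2 hu)).differentiableWithinAt
    · filter_upwards [h] with u hu
      exact hu.symm

end Continuation

/-! ### The square lattice -/

section SquareLattice

variable {m n : ℕ} (c : LatticeConvention)

theorem det_exponentMatrix_squareLattice (v : ℂ) :
    ((squareLattice m n c).exponentMatrix (I * v)).det = (squareLattice m n c).evenPolynomial v ^ 2 := by
  -- The order matrix compares only half-edges at a common vertex, where the rank and the
  -- lexicographic key agree.
  have h : orderMatrix (squareLattice m n c).rank (squareLattice m n c).vertexOf =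
      orderMatrix (latticeKey c) (latticeVertexOf c) := by
    rw [vertexOf_squareLattice]
    ext h k
    simp only [orderMatrix]
    split_ifs with hv
    · simp only [orderSign, latticeKey, hv, add_lt_add_iff_left]
      rfl
    · rfl
  rw [OrderedGraph.det_exponentMatrix, h, ← neg_smul_neg, ← pfaffianPolynomial_eval,
    det_pairingMatrix_sub (latticeKey_injective c) (latticeKey_lt_iff c)]

end SquareLattice

theorem mainTheorem10 (m n : ℕ) (c : LatticeConvention) :
    -- the defining integral converges absolutely for small weights
    (∀ᶠ v in 𝓝 (0 : ℂ), Integrable ((squareLattice m n c).generatingIntegrand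
      ((squareLattice m n c).homogeneousWeight (I * v)))) ∧
    -- wherever it converges absolutely it is given by the sum over even subgraphs
    (∀ v : ℂ, Integrable ((squareLattice m n c).generatingIntegrand
        ((squareLattice m n c).homogeneousWeight (I * v))) →
      (squareLattice m n c).evenPolynomial v ≠ 0 ∧
      (squareLattice m n c).generatingIntegral ((squareLattice m n c).homogeneousWeight (I * v)) =
        ((squareLattice m n c).evenPolynomial v ^ 2)⁻¹) ∧
    -- and so is its analytic continuation, defined exactly off the zeros of the polynomial
    (∀ v a : ℂ, (squareLattice m n c).HasGeneratingValue v a ↔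
      (squareLattice m n c).evenPolynomial v ≠ 0 ∧
      a = ((squareLattice m n c).evenPolynomial v ^ 2)⁻¹) ∧
    -- relation with the Ising partition function, with `v = tanh (β J)`
    (∀ β J : ℝ, (squareLattice m n c).HasGeneratingValue (Real.tanh (β * J) : ℂ)
      (((2 : ℝ) ^ (2 * ((m + 1) * (n + 1))) /
        ((1 - Real.tanh (β * J) ^ 2) ^ (m * (n + 1) + (m + 1) * n) *
          (squareLattice m n c).isingPartition β J ^ 2) : ℝ) : ℂ)) := by

  set Γ := squareLattice m n c
  have hsmall : ∀ᶠ v in 𝓝 (0 : ℂ), Integrable (Γ.generatingIntegrand (Γ.homogeneousWeight (I * v))) := by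
    have ht : Tendsto (fun v : ℂ => I * v) (𝓝 0) (𝓝 0) := by
      have : Continuous fun v : ℂ => I * v := by fun_prop
      simpa using this.tendsto 0
    filter_upwards [ht.eventually Γ.eventually_posDef] with v hv
    exact (Γ.integrable_generatingIntegrand_iff _).2 hv
  have hvalue : ∀ v : ℂ, Integrable (Γ.generatingIntegrand (Γ.homogeneousWeight (I * v))) →
      Γ.evenPolynomial v ≠ 0 ∧
      Γ.generatingIntegral (Γ.homogeneousWeight (I * v)) = (Γ.evenPolynomial v ^ 2)⁻¹ := by
    intro v hv
    obtain ⟨h1, h2⟩ := Γ.generatingIntegral_eq ((Γ.integrable_generatingIntegrand_iff _).1 hv)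
    rw [det_exponentMatrix_squareLattice] at h1 h2
    exact ⟨fun h0 => h1 (by rw [h0, zero_pow two_ne_zero]), h2⟩
  have hcontinuation := Γ.hasGeneratingValue_iff (hsmall.mono fun v hv => (hvalue v hv).2)
  refine ⟨hsmall, hvalue, hcontinuation, fun β J => (hcontinuation _ _).2 ?_⟩
  have hZ := Γ.isingPartition_eq β J
  have hZ0 : (Γ.isingPartition β J : ℂ) ≠ 0 := by exact_mod_cast (Γ.isingPartition_pos β J).ne'
  -- The Ising partition function is a sum of exponentials, hence positive, so `tanh (β J)` is never
  -- a zero of the polynomial.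
  have hp : Γ.evenPolynomial (Real.tanh (β * J) : ℂ) ≠ 0 := fun h0 => hZ0 (by rw [hZ, h0, mul_zero])
  refine ⟨hp, ?_⟩
  have hcosh : (Real.cosh (β * J) : ℂ) ≠ 0 := by exact_mod_cast (Real.cosh_pos _).ne'
  have htanh : 1 - (Real.tanh (β * J) : ℂ) ^ 2 = ((Real.cosh (β * J) : ℂ) ^ 2)⁻¹ := by
    have : 1 - Real.tanh (β * J) ^ 2 = (Real.cosh (β * J) ^ 2)⁻¹ := by
      have h0 := (Real.cosh_pos (β * J)).ne'
      rw [Real.tanh_eq_sinh_div_cosh]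
      field_simp
      rw [Real.cosh_sq]
      ring
    exact_mod_cast this
  simp only [Complex.ofReal_div, Complex.ofReal_mul, Complex.ofReal_pow, Complex.ofReal_sub,
    Complex.ofReal_one, Complex.ofReal_ofNat]
  rw [htanh, hZ, show Fintype.card (LatticeEdge m n) = m * (n + 1) + (m + 1) * n by simp,
    show Fintype.card (LatticeVertex m n) = (m + 1) * (n + 1) by simp,
    inv_pow, pow_right_comm, mul_comm 2 ((m + 1) * (n + 1)), pow_mul]
  have hcosh_pow := pow_ne_zero (m * (n + 1) + (m + 1) * n) hcosh
  generalize (Real.cosh (β * J) : ℂ) ^ (m * (n + 1) + (m + 1) * n) = a at hcosh_pow ⊢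
  field_simp
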